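/- Let $\nu\ge 0$, $N\ge 1$ be fixed integers. Consider the SISO fading ISI channel on one quasi-static block of length $N+\nu$: $y[n]=\sum_{m=0}^{\nu}h_m x[n-m]+z[n]$ for $0\le n<N+\nu$ (with $x[k]=0$ for $k<0$), where $h_0,\dots,h_\nu$ are i.i.d. $\mathcal{CN}(0,1)$, constant over the block and known to the receiver only, and the noise $z[n]$ is i.i.d. $\mathcal{CN}(0,1)$, independent of the $h_m$. A two-stream scheme is a family, indexed by $SNR$, of block codes of average transmit power at most $SNR$, for independent uniformly distributed messages of a high-priority and a low-priority stream (at least two messages each), with rates $R_H,R_L$ per time instant and average error probabilities $P_e^H,P_e^L$ of the two streams. It has multiplexing rates $r_H,r_L$ and diversity orders $d_H,d_L$ if, as $SNR\to\infty$, $R_H/\log SNR\to r_H$, $R_L/\log SNR\to r_L$, $-\log P_e^H/\log SNR\to d_H$ and $-\log P_e^L/\log SNR\to d_L$. Single-stream schemes, with multiplexing rate $r$ and diversity order $d$, are defined in the same way; $d_{isi}(r)$ denotes the supremum of the diversity orders of single-stream schemes with multiplexing rate $r$, and $d^{0}_{isi}(r)$ the same supremum over the schemes whose codewords are $N$ symbols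 followed by $\nu$ zeros. Let $r_H,r_L\ge 0$ with $r_H+r_L\le \frac{N}{N+\nu}$. Then the diversity-multiplexing tradeoff is successively refinable in the following sense. (1) There is a two-stream scheme with multiplexing rates $r_H,r_L$, formed by superposing two layers of uncoded QAM ($N$ independently chosen symbols, followed by $\nu$ zeros, with average power at most $SNR$ at each time instant), and decoded successively (minimum-distance decoding of the high-priority layer with the low-priority layer treated as noise, subtraction of its contribution, and minimum-distance decoding of the low-priority layer), whose diversity orders $d_H\ge d_L$ exist and satisfy $$(\nu+1)\Bigl(1-\tfrac{N+\nu}{N}r_H\Bigr)\le d_H\le(\nu+1)(1-r_H),$$ $$(\nu+1)\Bigl(1-\tfrac{N+\nu}{N}(r_H+r_L)\Bigr)\le d_L\le(\nu+1)\bigl(1-(r_H+r_L)\bigr),$$ and which match the single-stream tradeoff of zero-padded transmission: $d_H=d^0_{isi}(r_H)$ and $d_L=d^0_{isi}(r_H+r_L)$. (2) Every two-stream scheme, with any encoding and decoding, that has multiplexing rates $r_H,r_L$ and diversity orders $d_H,d_L$ satisfies $d_H\le(\nu+1)(1-r_H)$ and, if $d_H\ge d_L$, also $d_L\le(\nu+1)(1-(r_H+r_L))$.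 (3) The single-stream tradeoff obeys the same bounds: $(\nu+1)(1-\frac{N+\nu}{N}r)\le d_{isi}(r)\le(\nu+1)(1-r)$ for $r=r_H$ and for $r=r_H+r_L$. -/

import Mathlib

open MeasureTheory ProbabilityTheory Filter Topology
open scoped ENNReal NNReal

noncomputable section

namespace ISI

/-- The circularly symmetric complex Gaussian law with unit variance: the real and the imaginary
part are independent real Gaussians with mean `0` and variance `1 / 2`. -/
def stdComplexGaussian : Measure ℂ :=
  ((gaussianReal 0 (1 / 2)).prod (gaussianReal 0 (1 / 2))).map Complex.measurableEquivRealProd.symm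

/-- The `ν + 1` fading coefficients. -/
abbrev Taps (ν : ℕ) : Type := Fin (ν + 1) → ℂ

/-- Complex sequences indexed by the `N + ν` time instants of one quasi-static block. -/
abbrev Block (ν N : ℕ) : Type := Fin (N + ν) → ℂ

/-- Joint law of the (i.i.d.) fading coefficients and the (i.i.d.) additive noise of one block;
fading and noise are independent of each other. -/
def channelLaw (ν N : ℕ) : Measure (Taps ν × Block ν N) :=
  (Measure.pi fun _ : Fin (ν + 1) => stdComplexGaussian).prod
    (Measure.pi fun _ : Fin (N + ν) => stdComplexGaussian)

/-- Noiseless channel output `∑ₘ h[m] x[n - m]`; nothing is sent before time `0`. -/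
def convolve {ν N : ℕ} (h : Taps ν) (x : Block ν N) : Block ν N := fun n =>
  ∑ m : Fin (ν + 1),
    if m.val ≤ n.val then h m * x ⟨n.val - m.val, lt_of_le_of_lt (Nat.sub_le _ _) n.isLt⟩ else 0

/-- Received block, for the realisation `ω = (h, z)` of fading and noise. -/
def received {ν N : ℕ} (x : Block ν N) (ω : Taps ν × Block ν N) : Block ν N :=
  convolve ω.1 x + ω.2

/-- Squared Euclidean norm of a block. -/
def energy {ν N : ℕ} (x : Block ν N) : ℝ := ∑ n, ‖x n‖ ^ 2

/-- A block vanishing at the last `ν` time instants. -/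
def IsZeroPadded {ν N : ℕ} (x : Block ν N) : Prop := ∀ n : Fin (N + ν), N ≤ n.val → x n = 0

/-- The diversity order of a family of error probabilities indexed by the SNR `ρ` is `d`:
`-log P(ρ) / log ρ → d`, with `log 0 = -∞`. -/
def HasDiversity (P : ℝ → ℝ≥0∞) (d : EReal) : Prop :=
  Tendsto (fun ρ : ℝ => -(ENNReal.log (P ρ)) / ((Real.log ρ : ℝ) : EReal)) atTop (𝓝 d)

/-- The multiplexing rate of a family of transmission rates indexed by the SNR `ρ` is `r`. -/
def HasMultiplexing (R : ℝ → ℝ) (r : ℝ) : Prop :=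
  Tendsto (fun ρ : ℝ => R ρ / Real.log ρ) atTop (𝓝 r)

/-- A single-stream code for one block of `N + ν` time instants. The decoder, but not the encoder,
knows the fading coefficients. -/
structure Code (ν N : ℕ) where
  /-- number of messages -/
  M : ℕ
  two_le : 2 ≤ M
  /-- encoder -/
  enc : Fin M → Block ν N
  /-- decoder -/
  dec : Taps ν → Block ν N → Fin M
  measurable_dec : Measurable fun p : Taps ν × Block ν N => dec p.1 p.2

namespace Code

variable {ν N : ℕ} (C : Code ν N)

/-- Transmission rate per time instant. -/
def rate : ℝ := Real.log C.M / (N + ν)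

/-- Average transmit power over the block (and over the messages) is at most `ρ`. -/
def PowerLE (ρ : ℝ) : Prop := (∑ m, energy (C.enc m)) / C.M ≤ (N + ν) * ρ

/-- Average error probability. -/
def err : ℝ≥0∞ :=
  (∑ m, channelLaw ν N {ω | C.dec ω.1 (received (C.enc m) ω) ≠ m}) / C.M

end Code

/-- The diversity orders of single-stream schemes with multiplexing rate `r` on one block. -/
def diversities (ν N : ℕ) (r : ℝ) : Set EReal :=
  {d | ∃ C : ℝ → Code ν N, (∀ᶠ ρ in atTop, (C ρ).PowerLE ρ) ∧
    HasMultiplexing (fun ρ => (C ρ).rate) r ∧ HasDiversity (fun ρ => (C ρ).err) d}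

/-- The same, with all codewords padded with `ν` zeros. -/
def zeroPaddedDiversities (ν N : ℕ) (r : ℝ) : Set EReal :=
  {d | ∃ C : ℝ → Code ν N,
    (∀ᶠ ρ in atTop, (C ρ).PowerLE ρ ∧ ∀ m, IsZeroPadded ((C ρ).enc m)) ∧
    HasMultiplexing (fun ρ => (C ρ).rate) r ∧ HasDiversity (fun ρ => (C ρ).err) d}

/-- The single-stream diversity-multiplexing tradeoff of the ISI channel. -/
def tradeoff (ν N : ℕ) (r : ℝ) : EReal := sSup (diversities ν N r)

/-- The single-stream diversity-multiplexing tradeoff of the zero-padded ISI channel. -/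
def zeroPaddedTradeoff (ν N : ℕ) (r : ℝ) : EReal := sSup (zeroPaddedDiversities ν N r)

/-- A code for two message streams, jointly encoded and decoded on one block. -/
structure TwoStreamCode (ν N : ℕ) where
  /-- number of messages of the high-priority stream -/
  MH : ℕ
  /-- number of messages of the low-priority stream -/
  ML : ℕ
  two_le_MH : 2 ≤ MH
  two_le_ML : 2 ≤ ML
  /-- encoder -/
  enc : Fin MH → Fin ML → Block ν N
  /-- decoder of the high-priority stream -/
  decH : Taps ν → Block ν N → Fin MH
  /-- decoder of the low-priority stream -/
  decL : Taps ν → Block ν N → Fin ML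
  measurable_decH : Measurable fun p : Taps ν × Block ν N => decH p.1 p.2
  measurable_decL : Measurable fun p : Taps ν × Block ν N => decL p.1 p.2

/-- The point with index `p` of the square QAM constellation with `K ^ 2` points and minimum
distance `2 * a`, centred at the origin. -/
def qamPoint (K : ℕ) (a : ℝ) (p : Fin K × Fin K) : ℂ :=
  a * (((2 * (p.1.val : ℝ) - (K - 1) : ℝ) : ℂ) + ((2 * (p.2.val : ℝ) - (K - 1) : ℝ) : ℂ) * Complex.I)

/-- The block that carries `N` freely chosen QAM symbols followed by `ν` zeros. -/
def qamBlock (ν N K : ℕ) (a : ℝ) (s : Fin N → Fin K × Fin K) : Block ν N := fun n =>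
  if hn : n.val < N then qamPoint K a (s ⟨n.val, hn⟩) else 0

namespace TwoStreamCode

variable {ν N : ℕ} (C : TwoStreamCode ν N)

/-- Rate of the high-priority stream. -/
def rateH : ℝ := Real.log C.MH / (N + ν)

/-- Rate of the low-priority stream. -/
def rateL : ℝ := Real.log C.ML / (N + ν)

/-- Average transmit power over the block (and over the messages) is at most `ρ`. -/
def PowerLE (ρ : ℝ) : Prop :=
  (∑ i, ∑ j, energy (C.enc i j)) / (C.MH * C.ML) ≤ (N + ν) * ρ

/-- Average transmit power (over the messages) is at most `ρ` at every single time instant. -/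
def SymbolPowerLE (ρ : ℝ) : Prop :=
  ∀ n, (∑ i, ∑ j, ‖C.enc i j n‖ ^ 2) / (C.MH * C.ML) ≤ ρ

/-- Average error probability of the high-priority stream. -/
def errH : ℝ≥0∞ :=
  (∑ i, ∑ j, channelLaw ν N {ω | C.decH ω.1 (received (C.enc i j) ω) ≠ i}) / (C.MH * C.ML)

/-- Average error probability of the low-priority stream. -/
def errL : ℝ≥0∞ :=
  (∑ i, ∑ j, channelLaw ν N {ω | C.decL ω.1 (received (C.enc i j) ω) ≠ j}) / (C.MH * C.ML)

/-- Superposition of two uncoded, zero-padded QAM layers with successive decoding: messages are the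
sequences of `N` QAM symbols; the high-priority layer is decoded by minimum distance, treating the
low-priority layer as noise; its contribution is then subtracted, and the low-priority layer is
decoded by minimum distance. -/
def IsUncodedQAMSuccessive : Prop :=
  ∃ (KH KL : ℕ) (aH aL : ℝ) (eH : Fin C.MH ≃ (Fin N → Fin KH × Fin KH))
    (eL : Fin C.ML ≃ (Fin N → Fin KL × Fin KL)),
    0 < aH ∧ 0 < aL ∧
    (∀ i j, C.enc i j = qamBlock ν N KH aH (eH i) + qamBlock ν N KL aL (eL j)) ∧
    (∀ h y i, energy (y - convolve h (qamBlock ν N KH aH (eH (C.decH h y)))) ≤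
      energy (y - convolve h (qamBlock ν N KH aH (eH i)))) ∧
    (∀ h y j,
      energy (y - convolve h (qamBlock ν N KH aH (eH (C.decH h y)))
        - convolve h (qamBlock ν N KL aL (eL (C.decL h y)))) ≤
      energy (y - convolve h (qamBlock ν N KH aH (eH (C.decH h y)))
        - convolve h (qamBlock ν N KL aL (eL j))))

end TwoStreamCode

/-- A family of two-stream codes indexed by the SNR has multiplexing rates `rH`, `rL` and diversity
orders `dH`, `dL`. -/
structure HasTuple {ν N : ℕ} (C : ℝ → TwoStreamCode ν N) (rH : ℝ) (dH : EReal) (rL : ℝ)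
    (dL : EReal) : Prop where
  rateH : HasMultiplexing (fun ρ => (C ρ).rateH) rH
  divH : HasDiversity (fun ρ => (C ρ).errH) dH
  rateL : HasMultiplexing (fun ρ => (C ρ).rateL) rL
  divL : HasDiversity (fun ρ => (C ρ).errL) dL

/-- The value `(ν + 1) (1 - (N + ν) r / N)`. -/
def lowerBound (ν N : ℕ) (r : ℝ) : EReal := (((ν + 1) * (1 - (N + ν) / N * r) : ℝ) : EReal)

/-- The value `(ν + 1) (1 - r)`. -/
def upperBound (ν : ℕ) (r : ℝ) : EReal := (((ν + 1) * (1 - r) : ℝ) : EReal)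

end ISI

end

/-! Everything rests on one estimate: for small `t`, the vector `h` of `ν + 1` independent taps has
norm at most `t` with probability of order `t ^ (2 (ν + 1))`. Diversity orders then come from
finding the threshold on `‖h‖` below which decoding must fail and above which it works.

Converse. Suppose that, for each value of the other message, most words lie in a box with `k`
complex coordinates and side of order `ρ ^ (l / 2)`, and that there are about `ρ ^ (k θ)` of them.
If `‖h‖ ≤ ρ ^ (-(l - θ + δ) / 2)`, the noiseless outputs occupy at most of order `ρ ^ (k (θ - δ))`
cells of bounded size (just one in the limit if `θ = 0`). Words of one cell produce nearly the same
output law (`exists_dominating`), so on each cell the success probabilities of any decoder add up to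
at most 9/8 (`exists_sum_success_le`). The error probability thus stays bounded away from zero in
such a fade, and the order is at most `(ν + 1) (l - θ)` (`decaysAtMost_of_box`). The power
constraint gives `l = 1`; then `k = N + ν` yields the general upper bounds and `k = N` the
zero-padded ones. For the low-priority stream, the two messages are read as a single one
(`TwoStreamCode.joint`), whose error is at most the sum of the two errors.

Achievability. Zero-padding prevents the channel from nulling any difference of words: `c ‖h‖ ‖x‖ ≤
‖convolve h x‖` (`exists_le_norm_convolve`). A decoding error at spacing `a` therefore forces `a
‖h‖` to be at most a constant times `‖z‖`, an event of probability `O(a ^ (-2 (ν + 1)))`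
(`exists_outage_le`). The low layer is scaled to a small fraction of the spacing of the high layer.
As its interference passes through the same `h`, it fades together with the signal and costs only a
constant (`exists_err_isQAM_le`). With `α = (N + ν) rH / N` and `β = (N + ν) rL / N`, the squared
spacings have orders `ρ ^ (1 - α)` and `ρ ^ (1 - α - β)`.

For the existence of the limits, the converse is applied to these very codes, with `l = 1 - α` for
the low layer. The orders are exactly `(ν + 1) (1 - α)` and `(ν + 1) (1 - α - β)`, which also are
the zero-padded single-stream values. -/

namespace ISI

/-! ### Gaussian laws: domination of translates, small balls, moments. -/

section Gaussian

instance : IsProbabilityMeasure stdComplexGaussian :=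
  Measure.isProbabilityMeasure_map (MeasurableEquiv.measurable _).aemeasurable

/-- The product outer measure is the largest one bounded on boxes by the product of the factors, so
comparing boxes suffices. -/
theorem pi_measure_mono {ι : Type*} [Fintype ι] {X : ι → Type*} [∀ i, MeasurableSpace (X i)]
    {μ κ : ∀ i, Measure (X i)} (h : ∀ i, μ i ≤ κ i) : Measure.pi μ ≤ Measure.pi κ := by
  refine Measure.le_iff.2 fun s hs => ?_
  rw [Measure.pi, Measure.pi, toMeasure_apply _ _ hs, toMeasure_apply _ _ hs]
  refine (OuterMeasure.le_pi.2 fun t _ => ?_ : OuterMeasure.pi _ ≤ OuterMeasure.pi _) s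
  exact (OuterMeasure.pi_pi_le _ t).trans (Finset.prod_le_prod' fun i _ => h i (t i))

theorem pi_const_smul {ι X : Type*} [Fintype ι] [MeasurableSpace X] (μ : Measure X)
    [SigmaFinite μ] (A : ℝ≥0) :
    Measure.pi (fun _ : ι => (A : ℝ≥0∞) • μ) = ((A : ℝ≥0∞) ^ Fintype.card ι) • Measure.pi fun _ => μ := by
  have : SigmaFinite ((A : ℝ≥0∞) • μ) := inferInstanceAs (SigmaFinite (A • μ))
  refine Measure.pi_eq fun s _ => ?_
  simp [Measure.pi_pi, Finset.prod_mul_distrib]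

/-- Completing the square: the two exponents differ by `(m (1 + s) - s x) ^ 2 / (s (1 + s)) ≥ 0`.
The slightly larger variance is what lets a centred law dominate a translate with a constant close
to one. -/
theorem gaussianReal_le (m : ℝ) {s : ℝ≥0} (hs : 0 < s) :
    gaussianReal m (1 / 2) ≤
      ENNReal.ofReal (√(1 + s) * Real.exp (m ^ 2 / s)) • gaussianReal 0 ((1 + s) / 2) := by
  have h2 : ((1 + s) / 2 : ℝ≥0) ≠ 0 := by positivity
  rw [gaussianReal_of_var_ne_zero _ (by norm_num), gaussianReal_of_var_ne_zero _ h2,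
    ← withDensity_smul _ (measurable_gaussianPDF _ _)]
  refine withDensity_mono (ae_of_all _ fun x => ?_)
  rw [Pi.smul_apply, smul_eq_mul, gaussianPDF, gaussianPDF, ← ENNReal.ofReal_mul (by positivity)]
  refine ENNReal.ofReal_le_ofReal ?_
  have hs' : (0 : ℝ) < s := hs
  simp only [gaussianPDFReal, NNReal.coe_div, NNReal.coe_add, NNReal.coe_one, NNReal.coe_ofNat]
  have e1 : √(2 * Real.pi * ((1 + (s : ℝ)) / 2)) = √(1 + s) * √Real.pi := by
    rw [← Real.sqrt_mul (by positivity)]; congr 1; ring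
  have e2 : √(2 * Real.pi * (1 / 2)) = √Real.pi := by congr 1; ring
  rw [e1, e2, mul_inv]
  have h1 : √(1 + (s : ℝ)) ≠ 0 := by positivity
  have h3 : √(1 + (s : ℝ)) * Real.exp (m ^ 2 / s) * ((√(1 + (s : ℝ)))⁻¹ * (√Real.pi)⁻¹ *
      Real.exp (-(x - 0) ^ 2 / (2 * ((1 + s) / 2)))) =
      (√Real.pi)⁻¹ * Real.exp (m ^ 2 / s + -(x - 0) ^ 2 / (2 * ((1 + s) / 2))) := by
    rw [Real.exp_add]; field_simp
  rw [h3]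
  gcongr
  have h4 : m ^ 2 / s + -(x - 0) ^ 2 / (2 * ((1 + s) / 2)) - -(x - m) ^ 2 / (2 * (1 / 2)) =
      (m * (1 + s) - s * x) ^ 2 / (s * (1 + s)) := by
    field_simp; ring
  have h5 : 0 ≤ (m * (1 + s) - s * x) ^ 2 / (s * (1 + (s : ℝ))) := by positivity
  linarith

/-- The circularly symmetric complex Gaussian law with variance `1 + s`. -/
noncomputable def inflatedGaussian (s : ℝ≥0) : Measure ℂ :=
  ((gaussianReal 0 ((1 + s) / 2)).prod (gaussianReal 0 ((1 + s) / 2))).map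
    Complex.measurableEquivRealProd.symm

instance (s : ℝ≥0) : IsProbabilityMeasure (inflatedGaussian s) :=
  Measure.isProbabilityMeasure_map (MeasurableEquiv.measurable _).aemeasurable

theorem stdComplexGaussian_map_add_le (u : ℂ) {s : ℝ≥0} (hs : 0 < s) :
    stdComplexGaussian.map (· + u) ≤
      ENNReal.ofReal ((1 + s) * Real.exp (‖u‖ ^ 2 / s)) • inflatedGaussian s := by
  have h1 : stdComplexGaussian.map (· + u) =
      ((gaussianReal u.re (1 / 2)).prod (gaussianReal u.im (1 / 2))).map
        Complex.measurableEquivRealProd.symm := by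
    have e1 := gaussianReal_map_add_const (μ := 0) (v := 1 / 2) u.re
    have e2 := gaussianReal_map_add_const (μ := 0) (v := 1 / 2) u.im
    rw [zero_add] at e1 e2
    rw [← e1, ← e2, Measure.map_prod_map _ _ (by fun_prop) (by fun_prop), stdComplexGaussian,
      Measure.map_map (by fun_prop) (MeasurableEquiv.measurable _),
      Measure.map_map (MeasurableEquiv.measurable _) (by fun_prop)]
    congr 1
  have hu : ‖u‖ ^ 2 = u.re ^ 2 + u.im ^ 2 := by
    rw [Complex.sq_norm, Complex.normSq_apply]; ring
  rw [h1, inflatedGaussian, ← Measure.map_smul]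
  refine Measure.map_mono ?_ (MeasurableEquiv.measurable _)
  refine (Measure.prod_mono (gaussianReal_le u.re hs) (gaussianReal_le u.im hs)).trans ?_
  refine le_of_eq ?_
  refine (Measure.prod_smul_left _).trans ?_
  rw [Measure.prod_smul_right, smul_smul, ← ENNReal.ofReal_mul (by positivity)]
  congr 2
  rw [hu, add_div, Real.exp_add]
  have := Real.mul_self_sqrt (show (0 : ℝ) ≤ 1 + s by positivity)
  linear_combination Real.exp (u.re ^ 2 / s) * Real.exp (u.im ^ 2 / s) * this

/-- All small translates of a complex Gaussian vector are nearly dominated by one law. -/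
theorem exists_dominating (ι : Type*) [Fintype ι] :
    ∃ b : ℝ, 0 < b ∧ ∃ Q : Measure (ι → ℂ), IsProbabilityMeasure Q ∧ ∀ u : ι → ℂ, ‖u‖ ≤ b →
      (Measure.pi fun _ : ι => stdComplexGaussian).map (· + u) ≤ ENNReal.ofReal (9 / 8) • Q := by
  -- The number `s` serves both as variance increment and as radius: for `‖u‖ ≤ s` the exponent `‖u‖
  -- ^ 2 / s` is at most `s`. The constant 9/8 has to be below 3/2, so that a cell cannot account
  -- for 3/4 of the decisions when there are only two messages.
  obtain ⟨s, hs, hs1⟩ : ∃ s : ℝ, 0 < s ∧ ((1 + s) * Real.exp s) ^ Fintype.card ι ≤ 9 / 8 := by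
    have h : Tendsto (fun s : ℝ => ((1 + s) * Real.exp s) ^ Fintype.card ι) (𝓝[>] 0) (𝓝 1) := by
      have : Continuous fun s : ℝ => ((1 + s) * Real.exp s) ^ Fintype.card ι := by fun_prop
      simpa using (this.tendsto 0).mono_left (nhdsWithin_le_nhds (s := Set.Ioi 0))
    obtain ⟨s, h1, h2⟩ :=
      ((h.eventually_le_const (by norm_num : (1 : ℝ) < 9 / 8)).and self_mem_nhdsWithin).exists
    exact ⟨s, h2, h1⟩
  lift s to ℝ≥0 using hs.le
  have hs' : 0 < s := hs
  refine ⟨s, hs, Measure.pi fun _ => inflatedGaussian s, inferInstance, fun u hu => ?_⟩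
  have h1 : (Measure.pi fun _ : ι => stdComplexGaussian).map (· + u) =
      Measure.pi fun i => stdComplexGaussian.map (· + u i) := by
    have := Measure.pi_map_pi (μ := fun _ : ι => stdComplexGaussian)
      (f := fun i z => z + u i) (fun i => by fun_prop)
    rw [← this]; rfl
  rw [h1]
  have h2 : ∀ i, stdComplexGaussian.map (· + u i) ≤
      ((((1 + s) * (Real.exp s).toNNReal : ℝ≥0)) : ℝ≥0∞) • inflatedGaussian s := fun i => by
    refine (stdComplexGaussian_map_add_le (u i) hs').trans ?_
    refine Measure.le_iff'.2 fun t => ?_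
    simp only [Measure.smul_apply, smul_eq_mul]
    gcongr
    rw [ENNReal.ofReal]
    norm_cast
    rw [Real.toNNReal_mul (by positivity)]
    rw [Real.toNNReal_coe]
    gcongr
    have h3 : ‖u i‖ ≤ s := (norm_le_pi_norm u i).trans hu
    rw [div_le_iff₀ hs]
    nlinarith [norm_nonneg (u i)]
  refine (pi_measure_mono h2).trans ?_
  rw [pi_const_smul]
  refine Measure.le_iff'.2 fun t => ?_
  simp only [Measure.smul_apply, smul_eq_mul]
  gcongr
  rw [ENNReal.ofReal, ← ENNReal.coe_pow, ENNReal.coe_le_coe, ← NNReal.coe_le_coe]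
  simpa [Real.coe_toNNReal _ (Real.exp_pos _).le] using hs1.trans (le_max_left _ 0)

theorem gaussianReal_Icc_le (t : ℝ) :
    gaussianReal 0 (1 / 2) (Set.Icc (-t) t) ≤ ENNReal.ofReal (2 * t) := by
  rw [gaussianReal_apply _ (by norm_num)]
  calc ∫⁻ x in Set.Icc (-t) t, gaussianPDF 0 (1 / 2) x
      ≤ ∫⁻ x in Set.Icc (-t) t, 1 := by
        refine lintegral_mono fun x => ?_
        rw [gaussianPDF, ENNReal.ofReal_le_one, gaussianPDFReal]
        refine mul_le_one₀ (inv_le_one_of_one_le₀ ?_) (Real.exp_pos _).le (Real.exp_le_one_iff.2 ?_)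
        · rw [Real.one_le_sqrt]; simp; linarith [Real.pi_gt_three]
        · rw [neg_div]; simp only [NNReal.coe_div, NNReal.coe_one, NNReal.coe_ofNat, sub_zero]; simp; positivity
    _ = ENNReal.ofReal (2 * t) := by
        rw [setLIntegral_one, Real.volume_Icc]; congr 1; ring

theorem le_gaussianReal_Icc {t : ℝ} (ht1 : t ≤ 1) :
    ENNReal.ofReal (t / 8) ≤ gaussianReal 0 (1 / 2) (Set.Icc (-t) t) := by
  rw [gaussianReal_apply _ (by norm_num)]
  calc ENNReal.ofReal (t / 8) ≤ ENNReal.ofReal (1 / 16) * ENNReal.ofReal (t - -t) := by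
        rw [← ENNReal.ofReal_mul (by norm_num)]; apply le_of_eq; congr 1; ring
    _ = ∫⁻ x in Set.Icc (-t) t, ENNReal.ofReal (1 / 16) := by simp
    _ ≤ ∫⁻ x in Set.Icc (-t) t, gaussianPDF 0 (1 / 2) x := by
        refine setLIntegral_mono (measurable_gaussianPDF _ _) fun x hx => ?_
        refine ENNReal.ofReal_le_ofReal ?_
        rw [gaussianPDFReal]
        have hx1 : x ^ 2 ≤ 1 := by
          have := hx.1; have := hx.2; nlinarith
        have e : -(x - 0) ^ 2 / (2 * ((1 / 2 : ℝ≥0) : ℝ)) = - x ^ 2 := by simp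
        rw [e]
        have h1 : √(2 * Real.pi * ((1 / 2 : ℝ≥0) : ℝ)) ≤ 2 := by
          rw [Real.sqrt_le_iff]; constructor
          · norm_num
          · simp only [NNReal.coe_div, NNReal.coe_one, NNReal.coe_ofNat]; linarith [Real.pi_lt_four]
        have h2 : (1 / 2 : ℝ) ≤ (√(2 * Real.pi * ((1 / 2 : ℝ≥0) : ℝ)))⁻¹ := by
          rw [one_div]; apply inv_anti₀ _ h1
          have := Real.pi_pos
          simp only [NNReal.coe_div, NNReal.coe_one, NNReal.coe_ofNat]; positivity
        have h3 : (1 / 8 : ℝ) ≤ Real.exp (-x ^ 2) := by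
          refine le_trans ?_ (Real.exp_le_exp.2 (neg_le_neg hx1))
          rw [Real.exp_neg, one_div]
          exact inv_anti₀ (Real.exp_pos _) (by linarith [Real.exp_one_lt_d9])
        nlinarith [Real.exp_pos (-x ^ 2)]

theorem stdComplexGaussian_reProdIm {s t : Set ℝ} :
    stdComplexGaussian (s ×ℂ t) = gaussianReal 0 (1 / 2) s * gaussianReal 0 (1 / 2) t := by
  rw [stdComplexGaussian, MeasurableEquiv.map_apply, ← Measure.prod_prod]
  rfl

theorem stdComplexGaussian_closedBall_le {t : ℝ} (ht : 0 ≤ t) :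
    stdComplexGaussian (Metric.closedBall 0 t) ≤ ENNReal.ofReal (4 * t ^ 2) := by
  have h : Metric.closedBall (0 : ℂ) t ⊆ Set.Icc (-t) t ×ℂ Set.Icc (-t) t := fun z hz => by
    rw [mem_closedBall_zero_iff] at hz
    exact ⟨abs_le.1 ((Complex.abs_re_le_norm z).trans hz),
      abs_le.1 ((Complex.abs_im_le_norm z).trans hz)⟩
  refine (measure_mono h).trans ?_
  rw [stdComplexGaussian_reProdIm]
  refine (mul_le_mul' (gaussianReal_Icc_le t) (gaussianReal_Icc_le t)).trans ?_
  rw [← ENNReal.ofReal_mul (by positivity)]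
  apply le_of_eq; congr 1; ring

theorem le_stdComplexGaussian_closedBall {t : ℝ} (ht : 0 ≤ t) (ht1 : t ≤ 1) :
    ENNReal.ofReal (1 / 256 * t ^ 2) ≤ stdComplexGaussian (Metric.closedBall 0 t) := by
  have h : Set.Icc (-(t / 2)) (t / 2) ×ℂ Set.Icc (-(t / 2)) (t / 2) ⊆
      Metric.closedBall (0 : ℂ) t := fun z hz => by
    rw [mem_closedBall_zero_iff]
    have h1 := abs_le.2 hz.1
    have h2 := abs_le.2 hz.2
    linarith [Complex.norm_le_abs_re_add_abs_im z]
  refine le_trans ?_ (measure_mono h)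
  rw [stdComplexGaussian_reProdIm]
  refine le_trans ?_ (mul_le_mul' (le_gaussianReal_Icc (t := t / 2) (by linarith))
    (le_gaussianReal_Icc (t := t / 2) (by linarith)))
  rw [← ENNReal.ofReal_mul (by positivity)]
  apply le_of_eq; congr 1; ring

/-- A ball in the supremum norm is a product of discs, each of mass of order `t ^ 2`. With `ν + 1`
taps, this bound and the next one are the source of the factor `ν + 1` in all diversity orders. -/
theorem pi_stdComplexGaussian_closedBall_le {ι : Type*} [Fintype ι] {t : ℝ} (ht : 0 ≤ t) :
    (Measure.pi fun _ : ι => stdComplexGaussian) (Metric.closedBall 0 t) ≤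
      ENNReal.ofReal ((4 * t ^ 2) ^ Fintype.card ι) := by
  rw [Measure.pi_closedBall _ _ ht, ENNReal.ofReal_pow (by positivity)]
  exact Finset.prod_le_pow_card _ _ _ fun i _ => stdComplexGaussian_closedBall_le ht

theorem le_pi_stdComplexGaussian_closedBall {ι : Type*} [Fintype ι] {t : ℝ} (ht : 0 ≤ t)
    (ht1 : t ≤ 1) : ENNReal.ofReal ((1 / 256 * t ^ 2) ^ Fintype.card ι) ≤
      (Measure.pi fun _ : ι => stdComplexGaussian) (Metric.closedBall 0 t) := by
  rw [Measure.pi_closedBall _ _ ht, ENNReal.ofReal_pow (by positivity)]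
  exact Finset.pow_card_le_prod _ _ _ fun i _ => le_stdComplexGaussian_closedBall ht ht1

theorem lintegral_abs_pow_gaussianReal_lt_top (p : ℕ) :
    ∫⁻ x, ENNReal.ofReal (|x| ^ p) ∂gaussianReal 0 (1 / 2) < ∞ := by
  have h := (memLp_id_gaussianReal (μ := 0) (v := 1 / 2) p).integrable_norm_pow'
  have := h.lintegral_lt_top
  simpa using this

theorem lintegral_norm_pow_stdComplexGaussian_lt_top (p : ℕ) :
    ∫⁻ z, ENNReal.ofReal (‖z‖ ^ p) ∂stdComplexGaussian < ∞ := by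
  have hm : Measurable fun z : ℂ => ENNReal.ofReal (‖z‖ ^ p) := by fun_prop
  rw [stdComplexGaussian, lintegral_map_equiv]
  have hle : ∀ q : ℝ × ℝ, ENNReal.ofReal (‖Complex.measurableEquivRealProd.symm q‖ ^ p) ≤
      ENNReal.ofReal (2 ^ p * |q.1| ^ p) + ENNReal.ofReal (2 ^ p * |q.2| ^ p) := fun q => by
    rw [← ENNReal.ofReal_add (by positivity) (by positivity)]
    refine ENNReal.ofReal_le_ofReal ?_
    have h1 : ‖Complex.measurableEquivRealProd.symm q‖ ≤ |q.1| + |q.2| :=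
      Complex.norm_le_abs_re_add_abs_im _
    rw [← mul_pow, ← mul_pow]
    rcases le_total |q.1| |q.2| with h | h
    · refine le_trans ?_ (le_add_of_nonneg_left (by positivity))
      gcongr; linarith
    · refine le_trans ?_ (le_add_of_nonneg_right (by positivity))
      gcongr; linarith
  refine (lintegral_mono hle).trans_lt ?_
  have hf : ∀ g : ℝ × ℝ → ℝ, Measurable g → Measurable fun q => ENNReal.ofReal (2 ^ p * |g q| ^ p) :=
    fun g hg => by fun_prop
  rw [lintegral_add_left (hf _ measurable_fst)]
  have hp : ∫⁻ x, ENNReal.ofReal (2 ^ p * |x| ^ p) ∂gaussianReal 0 (1 / 2) < ∞ := by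
    simp_rw [ENNReal.ofReal_mul (show (0 : ℝ) ≤ 2 ^ p by positivity)]
    rw [lintegral_const_mul _ (by fun_prop)]
    exact ENNReal.mul_lt_top ENNReal.ofReal_lt_top (lintegral_abs_pow_gaussianReal_lt_top p)
  rw [ENNReal.add_lt_top]
  constructor
  · rw [lintegral_prod _ (hf _ measurable_fst).aemeasurable]; simpa using hp
  · rw [lintegral_prod _ (hf _ measurable_snd).aemeasurable]; simpa using hp

/-- The supremum norm is attained at a coordinate, so one coordinate moment dominates pointwise. For
an empty index type the sum is zero, hence the exclusion of `p = 0`. -/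
theorem lintegral_norm_pow_pi_lt_top {ι : Type*} [Fintype ι] {p : ℕ} (hp : p ≠ 0) :
    ∫⁻ z, ENNReal.ofReal (‖z‖ ^ p) ∂(Measure.pi fun _ : ι => stdComplexGaussian) < ∞ := by
  have hle : ∀ z : ι → ℂ, ENNReal.ofReal (‖z‖ ^ p) ≤ ∑ i, ENNReal.ofReal (‖z i‖ ^ p) := fun z => by
    rw [← ENNReal.ofReal_sum_of_nonneg fun i _ => by positivity]
    refine ENNReal.ofReal_le_ofReal ?_
    rcases isEmpty_or_nonempty ι with hι | hι
    · simp [hp, Subsingleton.elim z 0]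
    · obtain ⟨i, hi⟩ : ∃ i, ‖z‖ ≤ ‖z i‖ := by
        obtain ⟨i, -, hi⟩ := Finset.exists_max_image Finset.univ (fun i => ‖z i‖)
          Finset.univ_nonempty
        exact ⟨i, (pi_norm_le_iff_of_nonneg (norm_nonneg _)).2 fun j => hi j (Finset.mem_univ j)⟩
      refine (pow_le_pow_left₀ (norm_nonneg _) hi p).trans ?_
      exact Finset.single_le_sum (f := fun i => ‖z i‖ ^ p) (fun i _ => by positivity)
        (Finset.mem_univ i)
  refine (lintegral_mono hle).trans_lt ?_
  rw [lintegral_finsetSum _ fun i _ => by fun_prop]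
  refine ENNReal.sum_lt_top.2 fun i _ => ?_
  have := (measurePreserving_eval (fun _ : ι => stdComplexGaussian) i).lintegral_comp
    (f := fun z : ℂ => ENNReal.ofReal (‖z‖ ^ p)) (by fun_prop)
  simp only [Function.eval] at this
  rw [this]
  exact lintegral_norm_pow_stdComplexGaussian_lt_top p

end Gaussian

/-! ### Convolution with the taps, and its lower bound on zero-padded blocks. -/

section Convolution

variable {ν N : ℕ}

theorem convolve_add (h : Taps ν) (x y : Block ν N) :
    convolve h (x + y) = convolve h x + convolve h y := by
  ext n
  simp only [convolve, Pi.add_apply, ← Finset.sum_add_distrib]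
  refine Finset.sum_congr rfl fun m _ => ?_
  split_ifs <;> ring

theorem convolve_sub (h : Taps ν) (x y : Block ν N) :
    convolve h (x - y) = convolve h x - convolve h y := by
  rw [eq_sub_iff_add_eq, ← convolve_add, sub_add_cancel]

theorem convolve_smul_smul (a b : ℝ) (h : Taps ν) (x : Block ν N) :
    convolve (a • h) (b • x) = (a * b) • convolve h x := by
  ext n
  simp only [convolve, Pi.smul_apply, Finset.smul_sum, Complex.real_smul]
  refine Finset.sum_congr rfl fun m _ => ?_
  split_ifs
  · push_cast; ring
  · simp

theorem continuous_convolve : Continuous fun p : Taps ν × Block ν N => convolve p.1 p.2 := by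
  refine continuous_pi fun n => ?_
  simp only [convolve]
  refine continuous_finsetSum _ fun m _ => ?_
  split_ifs <;> fun_prop

@[fun_prop]
theorem measurable_convolve (x : Block ν N) : Measurable fun h : Taps ν => convolve h x :=
  (continuous_convolve.comp (Continuous.prodMk_left x)).measurable

theorem norm_convolve_le (h : Taps ν) (x : Block ν N) :
    ‖convolve h x‖ ≤ (ν + 1) * ‖h‖ * ‖x‖ := by
  refine (pi_norm_le_iff_of_nonneg (by positivity)).2 fun n => ?_
  refine (norm_sum_le _ _).trans ?_
  refine (Finset.sum_le_card_nsmul _ _ (‖h‖ * ‖x‖) fun m _ => ?_).trans_eq ?_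
  · split_ifs
    · rw [norm_mul]
      exact mul_le_mul (norm_le_pi_norm h m) (norm_le_pi_norm x _) (norm_nonneg _) (norm_nonneg _)
    · simp; positivity
  · simp [mul_assoc]

/-- As for polynomials over a domain: the first nonzero tap `i` and the first nonzero symbol `j`
meet alone at time `i + j`. Zero-padding gives `j < N`, so this instant still lies in the block. -/
theorem convolve_ne_zero {h : Taps ν} (hh : h ≠ 0) {x : Block ν N} (hx : x ≠ 0)
    (hz : IsZeroPadded x) : convolve h x ≠ 0 := by
  classical
  obtain ⟨i, hi, him⟩ : ∃ i, h i ≠ 0 ∧ ∀ m < i, h m = 0 := by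
    obtain ⟨i, hi⟩ := Function.ne_iff.1 hh
    obtain ⟨j, hj, hmin⟩ := WellFounded.has_min (wellFounded_lt (α := Fin (ν + 1))) {i | h i ≠ 0} ⟨i, hi⟩
    exact ⟨j, hj, fun m hm => by_contra fun h0 => hmin m h0 hm⟩
  obtain ⟨j, hj, hjm⟩ : ∃ j, x j ≠ 0 ∧ ∀ m < j, x m = 0 := by
    obtain ⟨i, hi⟩ := Function.ne_iff.1 hx
    obtain ⟨j, hj, hmin⟩ := WellFounded.has_min (wellFounded_lt (α := Fin (N + ν))) {i | x i ≠ 0} ⟨i, hi⟩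
    exact ⟨j, hj, fun m hm => by_contra fun h0 => hmin m h0 hm⟩
  have hjN : j.val < N := by
    by_contra h0
    exact hj (hz j (not_lt.1 h0))
  have hi' := i.isLt
  intro h0
  have h1 := congrFun h0 ⟨i.val + j.val, by omega⟩
  rw [convolve, Finset.sum_eq_single i] at h1
  · simp [hi, hj] at h1
  · intro m _ hm
    split_ifs with hle
    · rcases lt_or_gt_of_ne hm with hlt | hgt
      · rw [him m hlt, zero_mul]
      · rw [hjm _ (Fin.lt_def.2 _), mul_zero]
        have := Fin.lt_def.1 hgt
        simp only at hle ⊢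
        omega
    · rfl
  · simp

/-- Compactness of the product of the unit spheres turns nonvanishing into a uniform bound, and
homogeneity in each argument extends it. Up to constants, the channel acts on zero-padded words as a
scalar gain `‖h‖`. -/
theorem exists_le_norm_convolve (ν N : ℕ) : ∃ c : ℝ, 0 < c ∧ ∀ (h : Taps ν) (x : Block ν N),
    IsZeroPadded x → c * ‖h‖ * ‖x‖ ≤ ‖convolve h x‖ := by
  let S : Set (Taps ν × Block ν N) :=
    (Metric.sphere 0 1 ×ˢ Metric.sphere 0 1) ∩ {p | IsZeroPadded p.2}
  have hS : IsCompact S := by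
    refine ((isCompact_sphere _ _).prod (isCompact_sphere _ _)).inter_right ?_
    simp only [IsZeroPadded, Set.ofPred_forall]
    refine isClosed_iInter fun n => isClosed_iInter fun _ => ?_
    exact isClosed_eq (by fun_prop) continuous_const
  obtain ⟨c, hc, hcS⟩ : ∃ c : ℝ, 0 < c ∧ ∀ p ∈ S, c ≤ ‖convolve p.1 p.2‖ := by
    rcases S.eq_empty_or_nonempty with h0 | h0
    · exact ⟨1, one_pos, by simp [h0]⟩
    · obtain ⟨p, hp, hmin⟩ := hS.exists_isMinOn h0 continuous_convolve.norm.continuousOn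
      refine ⟨‖convolve p.1 p.2‖, norm_pos_iff.2 (convolve_ne_zero ?_ ?_ hp.2), fun q hq => hmin hq⟩
      · exact ne_zero_of_mem_unit_sphere ⟨p.1, hp.1.1⟩
      · exact ne_zero_of_mem_unit_sphere ⟨p.2, hp.1.2⟩
  refine ⟨c, hc, fun h x hx => ?_⟩
  rcases eq_or_ne h 0 with rfl | hh
  · simp
  rcases eq_or_ne x 0 with rfl | hx0
  · simp
  have hh' := norm_pos_iff.2 hh
  have hx' := norm_pos_iff.2 hx0
  have := hcS (‖h‖⁻¹ • h, ‖x‖⁻¹ • x) ⟨⟨by simp [norm_smul, hh'.ne'], by simp [norm_smul, hx'.ne']⟩,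
    fun n hn => by simp [hx n hn]⟩
  rw [convolve_smul_smul, norm_smul, Real.norm_of_nonneg (by positivity)] at this
  calc c * ‖h‖ * ‖x‖ ≤ (‖h‖⁻¹ * ‖x‖⁻¹ * ‖convolve h x‖) * ‖h‖ * ‖x‖ := by gcongr
    _ = ‖convolve h x‖ := by field_simp

theorem sq_norm_le_energy (x : Block ν N) : ‖x‖ ^ 2 ≤ energy x := by
  have h0 : 0 ≤ energy x := Finset.sum_nonneg fun n _ => by positivity
  rw [← Real.le_sqrt (norm_nonneg _) h0]
  refine (pi_norm_le_iff_of_nonneg (Real.sqrt_nonneg _)).2 fun n => Real.le_sqrt_of_sq_le ?_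
  exact Finset.single_le_sum (f := fun n => ‖x n‖ ^ 2) (fun i _ => by positivity)
    (Finset.mem_univ n)

theorem energy_le (x : Block ν N) : energy x ≤ (N + ν) * ‖x‖ ^ 2 := by
  refine (Finset.sum_le_card_nsmul _ _ (‖x‖ ^ 2) fun m _ => ?_).trans_eq ?_
  · gcongr; exact norm_le_pi_norm x m
  · simp

@[fun_prop]
theorem continuous_energy : Continuous (energy : Block ν N → ℝ) := by
  unfold energy; fun_prop

end Convolution

/-! ### Converse for a given fade: packing of the codewords into cells. -/

section Converse

theorem abs_round_le_floor {y B : ℝ} (h : |y| ≤ B) : |round y| ≤ (⌊B + 1 / 2⌋₊ : ℤ) := by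
  have h1 : |(round y : ℝ)| ≤ B + 1 / 2 := by
    have := abs_sub_round y
    have h2 : |(round y : ℝ)| ≤ |y| + |y - round y| := by
      have := abs_sub y (y - round y)
      simpa using this
    linarith
  have hB : 0 ≤ B + 1 / 2 := (abs_nonneg _).trans h1
  rw [Int.natCast_floor_eq_floor hB, Int.le_floor]
  exact_mod_cast h1

/-- The bound tends to 1 as `B → 0`. This is needed at multiplexing rate zero, where there may be
only two words and the number of cells must shrink to one. -/
theorem two_mul_floor_add_one_le {B : ℝ} (hB : 0 ≤ B) : (2 * ⌊B + 1 / 2⌋₊ + 1 : ℝ) ≤ 1 + 4 * B := by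
  rcases lt_or_ge B (1 / 2) with h | h
  · rw [Nat.floor_eq_zero.2 (by linarith)]; simp; linarith
  · have := Nat.floor_le (a := B + 1 / 2) (by linarith)
    linarith

theorem abs_sub_le_one_of_round_eq {y y' : ℝ} (h : round y = round y') : |y - y'| ≤ 1 := by
  have h1 := abs_le.1 (abs_sub_round y)
  have h2 := abs_le.1 (abs_sub_round y')
  rw [h] at h1
  rw [abs_le]; constructor <;> linarith [h1.1, h1.2, h2.1, h2.2]

variable {ν N : ℕ}

/-- For a given fading realisation, the sum of the success probabilities of codewords in a box of
side `R` and dimension `k` is bounded independently of the number of codewords. -/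
theorem exists_sum_success_le (ν N : ℕ) : ∃ c₀ : ℝ, 0 < c₀ ∧ ∀ (k : ℕ) (_ : k ≤ N + ν) (h : Taps ν)
    (R : ℝ) (M : ℕ) (w : Fin M → Block ν N) (c : Block ν N) (G : Finset (Fin M))
    (_ : ∀ m ∈ G, ∀ n : Fin (N + ν), k ≤ n.val → w m n = c n) (_ : ∀ m ∈ G, ‖w m - c‖ ≤ R)
    (dec : Block ν N → Fin M) (_ : Measurable dec), 0 ≤ R →
    ∑ m ∈ G, (Measure.pi fun _ : Fin (N + ν) => stdComplexGaussian)
        {z | dec (convolve h (w m) + z) = m} ≤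
      ENNReal.ofReal (9 / 8 * (1 + c₀ * ‖h‖ * R) ^ (2 * k)) := by
  classical
  obtain ⟨b, hb, Q, hQ, hdom⟩ := exists_dominating (Fin (N + ν))
  refine ⟨8 * (ν + 1) / b, by positivity, fun k hk h R M w c G hsupp hR dec hdec hR0 => ?_⟩
  set P := Measure.pi fun _ : Fin (N + ν) => stdComplexGaussian with hP
  -- Rounding after multiplication by `a` makes words of one cell satisfy `a ‖w - w'‖ ≤ 2`, which
  -- puts their outputs within distance `b`. Scaling up instead of dividing by a mesh size covers `h
  -- = 0` as well.
  set a : ℝ := 2 * (ν + 1) * ‖h‖ / b with ha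
  have ha0 : 0 ≤ a := by positivity
  set L : ℕ := ⌊a * R + 1 / 2⌋₊ with hL
  let box : Finset (Fin k → ℤ × ℤ) :=
    Fintype.piFinset fun _ => Finset.Icc (-(L : ℤ)) L ×ˢ Finset.Icc (-(L : ℤ)) L
  let cell : Fin M → Fin k → ℤ × ℤ := fun m n =>
    (round (a * ((w m - c) (Fin.castLE hk n)).re), round (a * ((w m - c) (Fin.castLE hk n)).im))
  have hcell : ∀ m ∈ G, cell m ∈ box := fun m hm => by
    refine Fintype.mem_piFinset.2 fun n => ?_
    have hn : ‖(w m - c) (Fin.castLE hk n)‖ ≤ R := (norm_le_pi_norm _ _).trans (hR m hm)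
    rw [Finset.mem_product, Finset.mem_Icc, Finset.mem_Icc, ← abs_le, ← abs_le]
    constructor <;> refine abs_round_le_floor ?_ <;> rw [abs_mul, abs_of_nonneg ha0]
    · exact mul_le_mul_of_nonneg_left ((Complex.abs_re_le_norm _).trans hn) ha0
    · exact mul_le_mul_of_nonneg_left ((Complex.abs_im_le_norm _).trans hn) ha0
  have hclose : ∀ m ∈ G, ∀ m' ∈ G, cell m = cell m' → ‖convolve h (w m - w m')‖ ≤ b := by
    intro m hm m' hm' heq
    have h1 : a * ‖w m - w m'‖ ≤ 2 := by
      rw [← Real.norm_of_nonneg ha0, ← norm_smul]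
      refine (pi_norm_le_iff_of_nonneg (by norm_num)).2 fun n => ?_
      rw [Pi.smul_apply, Pi.sub_apply]
      rcases lt_or_ge n.val k with hn | hn
      · have h2 := congrFun heq ⟨n.val, hn⟩
        simp only [cell, Prod.mk.injEq, Fin.castLE_mk, Fin.eta] at h2
        refine (Complex.norm_le_abs_re_add_abs_im _).trans ?_
        have h3 := abs_sub_le_one_of_round_eq h2.1
        have h4 := abs_sub_le_one_of_round_eq h2.2
        simp only [Pi.sub_apply, Complex.sub_re, Complex.sub_im, Complex.real_smul, Complex.re_ofReal_mul,
          Complex.im_ofReal_mul] at h3 h4 ⊢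
        rw [← mul_sub, sub_sub_sub_cancel_right] at h3 h4
        linarith
      · rw [hsupp m hm n hn, hsupp m' hm' n hn]; simp
    refine (norm_convolve_le h _).trans ?_
    have : (ν + 1) * ‖h‖ * ‖w m - w m'‖ = b / 2 * (a * ‖w m - w m'‖) := by
      rw [ha]; field_simp
    rw [this]; nlinarith
  -- Relative to one word `m₀` of the cell, all outputs follow laws dominated by `9/8 • Q`; the
  -- decision regions are disjoint, so their `Q`-masses add up to at most one.
  have hfib : ∀ κ ∈ box, ∑ m ∈ G with cell m = κ, P {z | dec (convolve h (w m) + z) = m} ≤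
      ENNReal.ofReal (9 / 8) := by
    intro κ _
    rcases (G.filter fun m => cell m = κ).eq_empty_or_nonempty with he | ⟨m₀, hm₀⟩
    · rw [he]; simp
    obtain ⟨hm₀G, hm₀κ⟩ := Finset.mem_filter.1 hm₀
    set D : Fin M → Set (Block ν N) := fun m => {y | dec (convolve h (w m₀) + y) = m} with hD
    have hDm : ∀ m, MeasurableSet (D m) := fun m =>
      (hdec.comp (measurable_const_add _)) (measurableSet_singleton m)
    calc ∑ m ∈ G with cell m = κ, P {z | dec (convolve h (w m) + z) = m}
        ≤ ∑ m ∈ G with cell m = κ, ENNReal.ofReal (9 / 8) * Q (D m) := by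
          refine Finset.sum_le_sum fun m hm => ?_
          obtain ⟨hmG, hmκ⟩ := Finset.mem_filter.1 hm
          have h1 := hdom _ (hclose m hmG m₀ hm₀G (hmκ.trans hm₀κ.symm)) (D m)
          rw [Measure.map_apply (by fun_prop) (hDm m)] at h1
          have h2 : (fun x => x + convolve h (w m - w m₀)) ⁻¹' D m =
              {z | dec (convolve h (w m) + z) = m} := by
            ext z
            change dec (convolve h (w m₀) + (z + convolve h (w m - w m₀))) = m ↔
              dec (convolve h (w m) + z) = m
            rw [convolve_sub, add_comm z, ← add_assoc, add_sub_cancel]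
          rwa [h2] at h1
      _ = ENNReal.ofReal (9 / 8) * ∑ m ∈ G with cell m = κ, Q (D m) := by rw [Finset.mul_sum]
      _ ≤ ENNReal.ofReal (9 / 8) * 1 := by
          gcongr
          rw [← measure_biUnion_finset _ fun m _ => hDm m]
          · exact prob_le_one
          · intro m _ m' _ hne
            refine Set.disjoint_left.2 fun y hy hy' => hne ?_
            exact hy.symm.trans hy'
      _ = _ := mul_one _
  rw [← Finset.sum_fiberwise_of_maps_to hcell]
  refine (Finset.sum_le_card_nsmul _ _ _ hfib).trans ?_
  have hcard : box.card = (2 * L + 1) ^ (2 * k) := by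
    simp only [box, Fintype.card_piFinset, Finset.card_product, Int.card_Icc, Finset.prod_const,
      Finset.card_univ, Fintype.card_fin]
    rw [pow_mul, sq]
    congr 2 <;> omega
  rw [nsmul_eq_mul, hcard, ← ENNReal.ofReal_natCast, ← ENNReal.ofReal_mul (by positivity)]
  refine ENNReal.ofReal_le_ofReal ?_
  rw [mul_comm]
  have h5 : (2 * L + 1 : ℝ) ≤ 1 + 8 * (ν + 1) / b * ‖h‖ * R := by
    refine (two_mul_floor_add_one_le (by positivity)).trans_eq ?_
    rw [ha]; ring
  push_cast
  gcongr

/-- Lower bound for the error probability of a family of codebooks whose words mostly lie in a box. -/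
theorem exists_le_error (ν N : ℕ) : ∃ c₀ : ℝ, 0 < c₀ ∧ ∀ (k : ℕ) (_ : k ≤ N + ν) (R t : ℝ)
    (A B : ℕ) (w : Fin A → Fin B → Block ν N) (c : Fin B → Block ν N) (G : Finset (Fin A × Fin B))
    (_ : 3 * (A * B) ≤ 4 * G.card)
    (_ : ∀ p ∈ G, ∀ n : Fin (N + ν), k ≤ n.val → w p.1 p.2 n = c p.2 n)
    (_ : ∀ p ∈ G, ‖w p.1 p.2 - c p.2‖ ≤ R)
    (dec : Taps ν → Block ν N → Fin A)
    (_ : Measurable fun p : Taps ν × Block ν N => dec p.1 p.2),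
    0 < A → 0 < B → 0 ≤ R → 0 ≤ t →
    ENNReal.ofReal (3 / 4 - 9 / 8 * (1 + c₀ * t * R) ^ (2 * k) / A) *

        (Measure.pi fun _ : Fin (ν + 1) => stdComplexGaussian) (Metric.closedBall 0 t) ≤
      (∑ i, ∑ j, channelLaw ν N {ω | dec ω.1 (received (w i j) ω) ≠ i}) / (A * B) := by
  classical
  obtain ⟨c₀, hc₀, hsucc⟩ := exists_sum_success_le ν N
  refine ⟨c₀, hc₀, fun k hk R t A B w c G hG hsupp hR dec hdec hA hB hR0 ht => ?_⟩
  set P := Measure.pi fun _ : Fin (N + ν) => stdComplexGaussian with hP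
  set μ := Measure.pi fun _ : Fin (ν + 1) => stdComplexGaussian with hμ
  set X : ℝ := 9 / 8 * (1 + c₀ * t * R) ^ (2 * k) with hX
  have hX0 : 0 ≤ X := by positivity
  have hrec : ∀ x : Block ν N, Measurable fun ω : Taps ν × Block ν N => received x ω := fun x =>
    ((measurable_convolve x).comp measurable_fst).add measurable_snd
  have hE : ∀ i j, MeasurableSet {ω : Taps ν × Block ν N | dec ω.1 (received (w i j) ω) ≠ i} :=
    fun i j => (hdec.comp (measurable_fst.prodMk (hrec (w i j))))
      (measurableSet_singleton i).compl
  have hdech : ∀ h, Measurable (dec h) := fun h => hdec.comp (measurable_const.prodMk measurable_id)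
  -- For a fixed fade, the errors on `G` number at least `G.card` minus the successes. For each
  -- value `j` of the other message the successes are at most `X`, whence the total `B * X`.
  have key : ∀ h ∈ Metric.closedBall (0 : Taps ν) t,
      ENNReal.ofReal (A * B * (3 / 4 - X / A)) ≤
        ∑ i, ∑ j, P {z | dec h (convolve h (w i j) + z) ≠ i} := by
    intro h hh
    rw [mem_closedBall_zero_iff] at hh
    have h1 : (G.card : ℝ≥0∞) ≤ (∑ i, ∑ j, P {z | dec h (convolve h (w i j) + z) ≠ i}) +
        B * ENNReal.ofReal X := by
      calc (G.card : ℝ≥0∞) = ∑ p ∈ G, (P {z | dec h (convolve h (w p.1 p.2) + z) ≠ p.1} +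
            P {z | dec h (convolve h (w p.1 p.2) + z) = p.1}) := by
            rw [← nsmul_one, ← Finset.sum_const]
            refine Finset.sum_congr rfl fun p _ => ?_
            have hm : MeasurableSet {z | dec h (convolve h (w p.1 p.2) + z) = p.1} :=
              ((hdech h).comp (measurable_const_add _)) (measurableSet_singleton p.1)
            rw [add_comm]
            exact (prob_add_prob_compl hm).symm
        _ = ∑ p ∈ G, P {z | dec h (convolve h (w p.1 p.2) + z) ≠ p.1} +
            ∑ p ∈ G, P {z | dec h (convolve h (w p.1 p.2) + z) = p.1} := Finset.sum_add_distrib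
        _ ≤ _ := by
            gcongr
            · rw [← Fintype.sum_prod_type']
              exact Finset.sum_le_sum_of_subset (Finset.subset_univ G)
            · have hmaps : ∀ p ∈ G, p.2 ∈ (Finset.univ : Finset (Fin B)) := fun _ _ => Finset.mem_univ _
              rw [← Finset.sum_fiberwise_of_maps_to hmaps]
              refine (Finset.sum_le_card_nsmul _ _ (ENNReal.ofReal X) fun j _ => ?_).trans_eq
                (by simp)
              have h2 := hsucc k hk h R A (fun i => w i j) (c j)
                (Finset.univ.filter fun i => (i, j) ∈ G)
                (fun i hi => hsupp (i, j) (by simpa using hi))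
                (fun i hi => hR (i, j) (by simpa using hi)) (dec h) (hdech h) hR0
              have h3 : ∑ p ∈ G with p.2 = j, P {z | dec h (convolve h (w p.1 p.2) + z) = p.1} =
                  ∑ i with (i, j) ∈ G, P {z | dec h (convolve h (w i j) + z) = i} := by
                symm
                refine Finset.sum_bij (fun i _ => (i, j)) (fun i hi => by simpa using hi)
                  (fun i _ i' _ h => (Prod.mk.inj h).1) (fun p hp => ?_) (fun _ _ => rfl)
                obtain ⟨hp1, hp2⟩ := Finset.mem_filter.1 hp
                exact ⟨p.1, by simp [← hp2, hp1], by simp [← hp2]⟩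
              rw [h3]
              refine h2.trans (ENNReal.ofReal_le_ofReal ?_)
              rw [hX]; gcongr
    have h2 : ENNReal.ofReal (A * B * (3 / 4 - X / A)) ≤ G.card - B * ENNReal.ofReal X := by
      rw [← ENNReal.ofReal_natCast, ← ENNReal.ofReal_natCast, ← ENNReal.ofReal_mul (by positivity),
        ← ENNReal.ofReal_sub _ (by positivity)]
      refine ENNReal.ofReal_le_ofReal ?_
      have h3 : (3 * (A * B) : ℝ) ≤ 4 * G.card := by exact_mod_cast hG
      have h4 : (A : ℝ) * B * (3 / 4 - X / A) = 3 / 4 * (A * B) - B * X := by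
        have : (A : ℝ) ≠ 0 := by positivity
        field_simp
      rw [h4]; linarith
    exact h2.trans (tsub_le_iff_right.2 h1)
  -- Fubini: given the fade, only the noise remains random. The integral is then restricted to the
  -- ball of weak fades.
  have hint : ∑ i, ∑ j, channelLaw ν N {ω | dec ω.1 (received (w i j) ω) ≠ i} =
      ∫⁻ h, ∑ i, ∑ j, P {z | dec h (convolve h (w i j) + z) ≠ i} ∂μ := by
    have hmeas : ∀ i j, Measurable fun h => P {z | dec h (convolve h (w i j) + z) ≠ i} :=
      fun i j => measurable_measure_prodMk_left (hE i j)
    rw [lintegral_finsetSum _ fun i _ => Finset.measurable_sum _ fun j _ => hmeas i j]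
    refine Finset.sum_congr rfl fun i _ => ?_
    rw [lintegral_finsetSum _ fun j _ => hmeas i j]
    refine Finset.sum_congr rfl fun j _ => ?_
    rw [channelLaw, Measure.prod_apply (hE i j)]
    rfl
  have hAB : (A : ℝ≥0∞) * B ≠ 0 := by simp; omega
  have hAB' : (A : ℝ≥0∞) * B ≠ ∞ := ENNReal.mul_ne_top (by simp) (by simp)
  rw [ENNReal.le_div_iff_mul_le (.inl hAB) (.inl hAB'), hint]
  calc ENNReal.ofReal (3 / 4 - X / A) * μ (Metric.closedBall 0 t) * (A * B)
      = ∫⁻ _ in Metric.closedBall (0 : Taps ν) t, ENNReal.ofReal (A * B * (3 / 4 - X / A)) ∂μ := by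
        rw [setLIntegral_const, ENNReal.ofReal_mul (by positivity),
          ENNReal.ofReal_mul (by positivity), ENNReal.ofReal_natCast, ENNReal.ofReal_natCast]
        ring
    _ ≤ ∫⁻ h in Metric.closedBall (0 : Taps ν) t,
          ∑ i, ∑ j, P {z | dec h (convolve h (w i j) + z) ≠ i} ∂μ :=
        setLIntegral_mono' Metric.isClosed_closedBall.measurableSet key
    _ ≤ _ := setLIntegral_le_lintegral _ _

end Converse

/-! ### Exponential orders in the SNR. -/

section Decay

theorem le_neg_log_div_log_iff {ρ : ℝ} (hρ : 1 < ρ) (x : ℝ) (p : ℝ≥0∞) :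
    (x : EReal) ≤ -(ENNReal.log p) / ((Real.log ρ : ℝ) : EReal) ↔ p ≤ ENNReal.ofReal (ρ ^ (-x)) := by
  have hl := Real.log_pos hρ
  have h0 : 0 < ρ := by linarith
  rw [EReal.le_div_iff_mul_le (by exact_mod_cast hl) (EReal.coe_ne_top _), EReal.le_neg,
    ← ENNReal.log_le_log_iff, ENNReal.log_ofReal_of_pos (by positivity), Real.log_rpow h0]
  norm_cast
  rw [neg_mul]

theorem neg_log_div_log_le_iff {ρ : ℝ} (hρ : 1 < ρ) (x : ℝ) (p : ℝ≥0∞) :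
    -(ENNReal.log p) / ((Real.log ρ : ℝ) : EReal) ≤ (x : EReal) ↔ ENNReal.ofReal (ρ ^ (-x)) ≤ p := by
  have hl := Real.log_pos hρ
  have h0 : 0 < ρ := by linarith
  rw [EReal.div_le_iff_le_mul (by exact_mod_cast hl) (EReal.coe_ne_top _), EReal.neg_le,
    ← ENNReal.log_le_log_iff, ENNReal.log_ofReal_of_pos (by positivity), Real.log_rpow h0]
  norm_cast
  rw [neg_mul, mul_comm x]

/-- The family `P` is eventually at least `ρ ^ (-(D + ε))`, for every `ε > 0`. -/
def DecaysAtMost (P : ℝ → ℝ≥0∞) (D : ℝ) : Prop :=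
  ∀ ε > 0, ∀ᶠ ρ in atTop, ENNReal.ofReal (ρ ^ (-(D + ε))) ≤ P ρ

theorem eventually_const_mul_rpow_le (C : ℝ) {a b : ℝ} (h : a < b) :
    ∀ᶠ ρ : ℝ in atTop, C * ρ ^ a ≤ ρ ^ b := by
  filter_upwards [(tendsto_rpow_atTop (sub_pos.2 h)).eventually_ge_atTop C, eventually_gt_atTop 0]
    with ρ h1 h2
  calc C * ρ ^ a ≤ ρ ^ (b - a) * ρ ^ a := by gcongr
    _ = ρ ^ b := by rw [← Real.rpow_add h2, sub_add_cancel]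

theorem DecaysAtMost.hasDiversity {P : ℝ → ℝ≥0∞} {D C : ℝ} (h : DecaysAtMost P D)
    (hC : ∀ᶠ ρ in atTop, P ρ ≤ ENNReal.ofReal (C * ρ ^ (-D))) : HasDiversity P D := by
  refine tendsto_order.2 ⟨fun a ha => ?_, fun a ha => ?_⟩
  · obtain ⟨x, hax, hxD⟩ := EReal.lt_iff_exists_real_btwn.1 ha
    have hxD' : x < D := by exact_mod_cast hxD
    filter_upwards [hC, eventually_gt_atTop 1,
      eventually_const_mul_rpow_le C (neg_lt_neg hxD')] with ρ h1 h2 h3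
    exact hax.trans_le ((le_neg_log_div_log_iff h2 x _).2 (h1.trans (ENNReal.ofReal_le_ofReal h3)))
  · obtain ⟨x, hDx, hxa⟩ := EReal.lt_iff_exists_real_btwn.1 ha
    have hDx' : D < x := by exact_mod_cast hDx
    filter_upwards [h (x - D) (sub_pos.2 hDx'), eventually_gt_atTop 1] with ρ h1 h2
    rw [add_sub_cancel] at h1
    exact ((neg_log_div_log_le_iff h2 x _).2 h1).trans_lt hxa

theorem HasDiversity.eventually_le {P : ℝ → ℝ≥0∞} {d : EReal} (h : HasDiversity P d) {x : ℝ}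
    (hx : x < d) : ∀ᶠ ρ in atTop, P ρ ≤ ENNReal.ofReal (ρ ^ (-x)) := by
  filter_upwards [h.eventually_const_lt hx, eventually_gt_atTop 1] with ρ h1 h2
  exact (le_neg_log_div_log_iff h2 x _).1 h1.le

theorem DecaysAtMost.not_forall_le {P : ℝ → ℝ≥0∞} {D x C : ℝ} (h : DecaysAtMost P D) (hx : D < x)
    (hC : ∀ᶠ ρ in atTop, P ρ ≤ ENNReal.ofReal (C * ρ ^ (-x))) : False := by
  have h1 := h ((x - D) / 2) (by linarith)
  have h2 : -x < -(D + (x - D) / 2) := by linarith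
  -- The factor 2 makes the contradiction strict, and `max C 1` covers a nonpositive `C`, which
  -- `ENNReal.ofReal` truncates to zero.
  obtain ⟨ρ, hP, hle, h3, h0⟩ := (h1.and (hC.and ((eventually_const_mul_rpow_le (2 * max C 1) h2).and
    (eventually_gt_atTop 0)))).exists
  have h4 := (ENNReal.ofReal_le_ofReal_iff' .. ).1 (hP.trans hle)
  have hp : 0 < ρ ^ (-x) := Real.rpow_pos_of_pos h0 _
  have hp' : 0 < ρ ^ (-(D + (x - D) / 2)) := Real.rpow_pos_of_pos h0 _
  have h5 : C * ρ ^ (-x) ≤ max C 1 * ρ ^ (-x) := by gcongr; exact le_max_left _ _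
  have h6 : 1 * ρ ^ (-x) ≤ max C 1 * ρ ^ (-x) := by gcongr; exact le_max_right _ _
  rcases h4 with h4 | h4 <;> nlinarith

theorem DecaysAtMost.le_of_hasDiversity {P : ℝ → ℝ≥0∞} {d : EReal} {D : ℝ} (h : DecaysAtMost P D)
    (hd : HasDiversity P d) : d ≤ D := by
  refine le_of_not_gt fun hlt => ?_
  obtain ⟨x, hDx, hxd⟩ := EReal.lt_iff_exists_real_btwn.1 hlt
  refine h.not_forall_le (C := 1) (by exact_mod_cast hDx) ?_
  simpa using hd.eventually_le hxd

/-- A sum decays at the rate of its slower term. This is where the ordering of the two diversity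
orders enters: the bound on the sum constrains only the smaller order. -/
theorem DecaysAtMost.le_of_hasDiversity_add {P P' : ℝ → ℝ≥0∞} {d d' : EReal} {D : ℝ}
    (h : DecaysAtMost (fun ρ => P ρ + P' ρ) D) (hd : HasDiversity P d) (hd' : HasDiversity P' d')
    (hle : d' ≤ d) : d' ≤ D := by
  refine le_of_not_gt fun hlt => ?_
  obtain ⟨x, hDx, hxd⟩ := EReal.lt_iff_exists_real_btwn.1 hlt
  refine h.not_forall_le (C := 2) (by exact_mod_cast hDx) ?_
  filter_upwards [hd.eventually_le (hxd.trans_le hle), hd'.eventually_le hxd] with ρ h1 h2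
  refine (add_le_add h1 h2).trans_eq ?_
  rw [← two_mul, ENNReal.ofReal_mul (by norm_num)]
  simp

theorem DecaysAtMost.mono {P P' : ℝ → ℝ≥0∞} {D : ℝ} (h : DecaysAtMost P D)
    (hle : ∀ ρ, P ρ ≤ P' ρ) : DecaysAtMost P' D := fun ε hε =>
  (h ε hε).mono fun ρ hρ => hρ.trans (hle ρ)

theorem HasMultiplexing.eventually_rpow_le {M : ℝ → ℕ} {n r s : ℝ} (hn : 0 < n)
    (hM : ∀ᶠ ρ in atTop, 0 < M ρ)
    (h : HasMultiplexing (fun ρ => Real.log (M ρ) / n) r) (hs : s < n * r) :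
    ∀ᶠ ρ : ℝ in atTop, ρ ^ s ≤ M ρ := by
  have h1 : s / n < r := by rwa [div_lt_iff₀' hn]
  filter_upwards [h.eventually_const_lt h1, eventually_gt_atTop 1, hM] with ρ h2 h3 h4
  have hl := Real.log_pos h3
  rw [lt_div_iff₀ hl, div_mul_eq_mul_div, div_lt_div_iff_of_pos_right hn] at h2
  have hM' : (0 : ℝ) < M ρ := by exact_mod_cast h4
  rw [← Real.log_le_log_iff (by positivity) hM', Real.log_rpow (by linarith)]
  exact h2.le

end Decay

/-! ### Converse for families of codes: diversity upper bounds. -/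

section Converse

variable {ν N : ℕ}

/-- For `θ > 0` the number of cells is of order `ρ ^ (k (θ - δ))`, which loses against `ρ ^ (k (θ -
δ / 2))` words, whatever the constants. For `θ = 0` the number of cells tends to one while there are
at least two words; `9/8 * 10/9 / 2 = 5/8` leaves a margin of 1/8 below 3/4. -/
theorem eventually_packing_le {k : ℕ} (hk : 0 < k) {θ δ b : ℝ} (hθ : 0 ≤ θ) (hδ : 0 < δ)
    (hδθ : 0 < θ → δ ≤ θ) (hb : 0 ≤ b) {A : ℝ → ℕ} (hA : ∀ᶠ ρ in atTop, 2 ≤ A ρ)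
    (hgrow : ∀ s < k * θ, ∀ᶠ ρ : ℝ in atTop, ρ ^ s ≤ A ρ) :
    ∀ᶠ ρ : ℝ in atTop, 9 / 8 * (1 + b * ρ ^ ((θ - δ) / 2)) ^ (2 * k) / A ρ ≤ 5 / 8 := by
  rcases hθ.eq_or_lt with rfl | hθ
  · have h1 : Tendsto (fun ρ : ℝ => (1 + b * ρ ^ ((0 - δ) / 2)) ^ (2 * k)) atTop (𝓝 1) := by
      have h2 : Tendsto (fun ρ : ℝ => ρ ^ ((0 - δ) / 2)) atTop (𝓝 0) := by
        have := tendsto_rpow_neg_atTop (half_pos hδ)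
        refine this.congr fun ρ => ?_
        congr 1; ring
      simpa using ((h2.const_mul b).const_add 1).pow (2 * k)
    filter_upwards [h1.eventually_le_const (by norm_num : (1 : ℝ) < 10 / 9), hA] with ρ h2 h3
    have h3' : (2 : ℝ) ≤ A ρ := by exact_mod_cast h3
    rw [div_le_iff₀ (by linarith)]
    linarith
  · have hlt : k * (θ - δ) < k * (θ - δ / 2) := by
      have : (0 : ℝ) < k := by exact_mod_cast hk
      gcongr; linarith
    have hlt' : k * (θ - δ / 2) < k * θ := by
      have : (0 : ℝ) < k := by exact_mod_cast hk
      gcongr; linarith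
    filter_upwards [hgrow _ hlt', hA, eventually_ge_atTop 1,
      eventually_const_mul_rpow_le (9 / 5 * (1 + b) ^ (2 * k)) hlt] with ρ h1 h2 h3 h4
    have h2' : (2 : ℝ) ≤ A ρ := by exact_mod_cast h2
    rw [div_le_iff₀ (by linarith)]
    have h5 : 1 ≤ ρ ^ ((θ - δ) / 2) := Real.one_le_rpow h3 (by linarith [hδθ hθ])
    have h6 : (1 + b * ρ ^ ((θ - δ) / 2)) ^ (2 * k) ≤ (1 + b) ^ (2 * k) * ρ ^ (k * (θ - δ)) := by
      calc (1 + b * ρ ^ ((θ - δ) / 2)) ^ (2 * k)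
          ≤ ((1 + b) * ρ ^ ((θ - δ) / 2)) ^ (2 * k) := by
            gcongr; rw [add_mul, one_mul]; gcongr
        _ = _ := by
            rw [mul_pow, ← Real.rpow_natCast (ρ ^ _), ← Real.rpow_mul (by linarith)]
            congr 2; push_cast; ring
    nlinarith

/-- Codebooks whose words mostly lie in boxes of dimension `k` and side of order `ρ ^ (l / 2)`, and
that have about `ρ ^ (k θ)` words, have diversity order at most `(ν + 1) (l - θ)`. -/
theorem decaysAtMost_of_box {k : ℕ} (hk0 : 0 < k) (hk : k ≤ N + ν) {l θ C : ℝ} (hθ : 0 ≤ θ)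
    (hθl : θ ≤ l) (hC : 0 ≤ C) (A B : ℝ → ℕ) (w : ∀ ρ, Fin (A ρ) → Fin (B ρ) → Block ν N)
    (dec : ∀ ρ, Taps ν → Block ν N → Fin (A ρ))
    (hdec : ∀ ρ, Measurable fun p : Taps ν × Block ν N => dec ρ p.1 p.2)
    (hA : ∀ᶠ ρ in atTop, 2 ≤ A ρ) (hB : ∀ᶠ ρ in atTop, 0 < B ρ)
    (hgrow : ∀ s < k * θ, ∀ᶠ ρ : ℝ in atTop, ρ ^ s ≤ A ρ)
    (hbox : ∀ᶠ ρ : ℝ in atTop, ∃ (c : Fin (B ρ) → Block ν N) (G : Finset (Fin (A ρ) × Fin (B ρ))),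
      3 * (A ρ * B ρ) ≤ 4 * G.card ∧ ∀ p ∈ G,
        (∀ n : Fin (N + ν), k ≤ n.val → w ρ p.1 p.2 n = c p.2 n) ∧
        ‖w ρ p.1 p.2 - c p.2‖ ≤ C * ρ ^ (l / 2)) :
    DecaysAtMost (fun ρ => (∑ i, ∑ j,
      channelLaw ν N {ω | dec ρ ω.1 (received (w ρ i j) ω) ≠ i}) / (A ρ * B ρ))
      ((ν + 1) * (l - θ)) := by
  intro ε hε
  obtain ⟨c₀, hc₀, herr⟩ := exists_le_error ν N
  -- The fade is made deeper than the critical one by `δ`, so that packing fails; this costs `(ν +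
  -- 1) δ < ε` in the exponent.
  obtain ⟨δ, hδ, hδε, hδθ⟩ : ∃ δ : ℝ, 0 < δ ∧ (ν + 1) * δ < ε ∧ (0 < θ → δ ≤ θ) := by
    have h1 : (ν + 1) * (ε / (2 * (ν + 1))) < ε := by
      have : (ν + 1) * (ε / (2 * (ν + 1))) = ε / 2 := by field_simp
      linarith
    rcases hθ.eq_or_lt with h0 | h0
    · exact ⟨ε / (2 * (ν + 1)), by positivity, h1, fun h => absurd h (by linarith)⟩
    · refine ⟨min (ε / (2 * (ν + 1))) θ, by positivity, lt_of_le_of_lt ?_ h1, fun _ => min_le_right _ _⟩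
      gcongr; exact min_le_left _ _
  have hlt : -((ν + 1) * (l - θ) + ε) < -((ν + 1) * (l - θ + δ)) := by linarith
  filter_upwards [hA, hB, hbox, eventually_ge_atTop 1,
    eventually_packing_le hk0 hθ hδ hδθ (by positivity : 0 ≤ c₀ * C) hA hgrow,
    eventually_const_mul_rpow_le (8 * 256 ^ (ν + 1)) hlt] with ρ hA hB hbox hρ hpack hlast
  obtain ⟨c, G, hG, hGp⟩ := hbox
  have hρ0 : 0 < ρ := by linarith
  set t : ℝ := ρ ^ (-(l - θ + δ) / 2) with ht
  have ht0 : 0 ≤ t := by positivity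
  have ht1 : t ≤ 1 := Real.rpow_le_one_of_one_le_of_nonpos hρ (by linarith)
  have h1 := herr k hk (C * ρ ^ (l / 2)) t (A ρ) (B ρ) (w ρ) c G hG (fun p hp => (hGp p hp).1)
    (fun p hp => (hGp p hp).2) (dec ρ) (hdec ρ) (by omega) hB (by positivity) ht0
  refine le_trans ?_ h1
  have h2 : c₀ * t * (C * ρ ^ (l / 2)) = c₀ * C * ρ ^ ((θ - δ) / 2) := by
    have : t * ρ ^ (l / 2) = ρ ^ ((θ - δ) / 2) := by
      rw [ht, ← Real.rpow_add hρ0]; congr 1; ring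
    rw [← this]; ring
  rw [h2]
  have h3 := le_pi_stdComplexGaussian_closedBall (ι := Fin (ν + 1)) ht0 ht1
  refine le_trans ?_ (mul_le_mul' (ENNReal.ofReal_le_ofReal
    (by linarith : (1 / 8 : ℝ) ≤ 3 / 4 - _)) h3)
  rw [← ENNReal.ofReal_mul (by norm_num), Fintype.card_fin]
  refine ENNReal.ofReal_le_ofReal ?_
  have h4 : (1 / 256 * t ^ 2) ^ (ν + 1) = (256 ^ (ν + 1))⁻¹ * ρ ^ (-((ν + 1) * (l - θ + δ))) := by
    rw [mul_pow, ← pow_mul, ← Real.rpow_natCast t, ht, ← Real.rpow_mul hρ0.le, one_div, inv_pow]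
    congr 2; push_cast; ring
  rw [h4]
  have h5 : (0 : ℝ) < 256 ^ (ν + 1) := by positivity
  calc ρ ^ (-((ν + 1) * (l - θ) + ε))
      = 1 / 8 * ((256 ^ (ν + 1))⁻¹ * (8 * 256 ^ (ν + 1) * ρ ^ (-((ν + 1) * (l - θ) + ε)))) := by
        field_simp
    _ ≤ _ := by gcongr

/-- Markov's inequality: at most a quarter of the indices exceed four times the bound `a` on the
average. It turns average power into a box containing most words. -/
theorem card_mul_three_le_of_sum_le {ι : Type*} [Fintype ι] {f : ι → ℝ} (hf : ∀ i, 0 ≤ f i) {a : ℝ}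
    (ha : 0 < a) (h : ∑ i, f i ≤ Fintype.card ι * a) :
    3 * Fintype.card ι ≤ 4 * (Finset.univ.filter fun i => f i ≤ 4 * a).card := by
  classical
  have h1 := Finset.card_filter_add_card_filter_not (s := Finset.univ) (fun i => f i ≤ 4 * a)
  rw [Finset.card_univ] at h1
  have h2 : ((Finset.univ.filter fun i => ¬ f i ≤ 4 * a).card : ℝ) * (4 * a) ≤ Fintype.card ι * a := by
    rw [← nsmul_eq_mul]
    refine (Finset.card_nsmul_le_sum _ f _ fun i hi => ?_).trans
      ((Finset.sum_le_univ_sum_of_nonneg hf).trans h)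
    exact (not_le.1 (Finset.mem_filter.1 hi).2).le
  have h3 : ((Finset.univ.filter fun i => ¬ f i ≤ 4 * a).card : ℝ) * 4 ≤ Fintype.card ι := by
    nlinarith
  have h4 : (Finset.univ.filter fun i => ¬ f i ≤ 4 * a).card * 4 ≤ Fintype.card ι := by
    exact_mod_cast h3
  omega

/-- Codebooks with an average power constraint. -/
theorem decaysAtMost_of_power {k : ℕ} (hk0 : 0 < k) (hk : k ≤ N + ν) {r : ℝ} (hr : 0 ≤ r)
    (hrk : (N + ν) * r ≤ k) (A B : ℝ → ℕ) (w : ∀ ρ, Fin (A ρ) → Fin (B ρ) → Block ν N)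
    (dec : ∀ ρ, Taps ν → Block ν N → Fin (A ρ))
    (hdec : ∀ ρ, Measurable fun p : Taps ν × Block ν N => dec ρ p.1 p.2)
    (hA : ∀ ρ, 2 ≤ A ρ) (hB : ∀ ρ, 0 < B ρ)
    (hrate : HasMultiplexing (fun ρ => Real.log (A ρ) / (N + ν)) r)
    (hsupp : ∀ᶠ ρ in atTop, ∀ i j, ∀ n : Fin (N + ν), k ≤ n.val → w ρ i j n = 0)
    (hpow : ∀ᶠ ρ in atTop, (∑ i, ∑ j, energy (w ρ i j)) / (A ρ * B ρ) ≤ (N + ν) * ρ) :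
    DecaysAtMost (fun ρ => (∑ i, ∑ j,
      channelLaw ν N {ω | dec ρ ω.1 (received (w ρ i j) ω) ≠ i}) / (A ρ * B ρ))
      ((ν + 1) * (1 - (N + ν) / k * r)) := by
  have hk0' : (0 : ℝ) < k := by exact_mod_cast hk0
  have hn : (0 : ℝ) < N + ν := by
    have : (k : ℝ) ≤ N + ν := by exact_mod_cast hk
    linarith
  -- Here `l = 1` and `θ = (N + ν) r / k`, because `ρ ^ ((N + ν) r)` messages are spread over `k`
  -- coordinates. All boxes are centred at the origin.
  refine decaysAtMost_of_box hk0 hk (C := 2 * √(N + ν)) (by positivity) ?_ (by positivity) A B w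
    dec hdec (.of_forall hA) (.of_forall hB) ?_ ?_
  · rwa [div_mul_eq_mul_div, div_le_one hk0']
  · intro s hs
    refine hrate.eventually_rpow_le hn (.of_forall fun ρ => by have := hA ρ; omega) ?_
    rwa [← mul_assoc, mul_div_cancel₀ _ hk0'.ne'] at hs
  · filter_upwards [hsupp, hpow, eventually_gt_atTop 0] with ρ h1 h2 h3
    have hA' : (0 : ℝ) < A ρ := by have := hA ρ; exact_mod_cast (by omega : 0 < A ρ)
    have hB' : (0 : ℝ) < B ρ := by exact_mod_cast hB ρ
    refine ⟨0, Finset.univ.filter fun p => energy (w ρ p.1 p.2) ≤ 4 * ((N + ν) * ρ), ?_,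
      fun p hp => ⟨h1 p.1 p.2, ?_⟩⟩
    · have := card_mul_three_le_of_sum_le (f := fun p : Fin (A ρ) × Fin (B ρ) => energy (w ρ p.1 p.2))
        (fun p => Finset.sum_nonneg fun n _ => by positivity) (by positivity : 0 < (N + ν) * ρ) ?_
      · simpa using this
      · rw [Fintype.sum_prod_type]
        rw [div_le_iff₀ (by positivity)] at h2
        simp only [Fintype.card_prod, Fintype.card_fin, Nat.cast_mul]
        linarith
    · have h4 := (sq_norm_le_energy _).trans (Finset.mem_filter.1 hp).2
      have e : 2 * √(N + ν) * ρ ^ (1 / 2 : ℝ) = √(4 * ((N + ν) * ρ)) := by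
        rw [← Real.sqrt_eq_rpow, Real.sqrt_mul (by norm_num), Real.sqrt_mul hn.le,
          show (4 : ℝ) = 2 ^ 2 by norm_num, Real.sqrt_sq (by norm_num), mul_assoc]
      rw [Pi.zero_apply, sub_zero, e]
      exact Real.le_sqrt_of_sq_le h4

/-- A single stream is the case of one message in the other stream. Zero-padded codes correspond to
`k = N`, unrestricted ones to `k = N + ν`. -/
theorem decaysAtMost_err {k : ℕ} (hk0 : 0 < k) (hk : k ≤ N + ν) {r : ℝ} (hr : 0 ≤ r)
    (hrk : (N + ν) * r ≤ k) (C : ℝ → Code ν N)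
    (hrate : HasMultiplexing (fun ρ => (C ρ).rate) r)
    (hsupp : ∀ᶠ ρ in atTop, ∀ m, ∀ n : Fin (N + ν), k ≤ n.val → (C ρ).enc m n = 0)
    (hpow : ∀ᶠ ρ in atTop, (C ρ).PowerLE ρ) :
    DecaysAtMost (fun ρ => (C ρ).err) ((ν + 1) * (1 - (N + ν) / k * r)) := by
  have := decaysAtMost_of_power hk0 hk hr hrk (fun ρ => (C ρ).M) (fun _ => 1)
    (fun ρ i _ => (C ρ).enc i) (fun ρ => (C ρ).dec) (fun ρ => (C ρ).measurable_dec)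
    (fun ρ => (C ρ).two_le) (fun _ => one_pos) hrate (hsupp.mono fun ρ h i _ => h i)
    (hpow.mono fun ρ h => by simpa [Code.PowerLE] using h)
  simpa [Code.err] using this

/-- The low-priority message merely indexes a collection of codebooks for the high-priority stream,
all served by the same decoder; power is averaged over the collection. -/
theorem decaysAtMost_errH (hN : 1 ≤ N) {r : ℝ} (hr : 0 ≤ r) (hr1 : r ≤ 1) (C : ℝ → TwoStreamCode ν N)
    (hrate : HasMultiplexing (fun ρ => (C ρ).rateH) r)
    (hpow : ∀ᶠ ρ in atTop, (C ρ).PowerLE ρ) :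
    DecaysAtMost (fun ρ => (C ρ).errH) ((ν + 1) * (1 - r)) := by
  have hn : (0 : ℝ) < N + ν := by
    have : (1 : ℝ) ≤ N := by exact_mod_cast hN
    positivity
  have := decaysAtMost_of_power (k := N + ν) (by omega) le_rfl hr (by push_cast; nlinarith)
    (fun ρ => (C ρ).MH) (fun ρ => (C ρ).ML)
    (fun ρ => (C ρ).enc) (fun ρ => (C ρ).decH) (fun ρ => (C ρ).measurable_decH)
    (fun ρ => (C ρ).two_le_MH) (fun ρ => by have := (C ρ).two_le_ML; omega) hrate
    (.of_forall fun ρ i j n h => absurd n.isLt (by omega)) hpow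
  push_cast at this
  rwa [div_self hn.ne', one_mul] at this

/-- A two-stream code as a single-stream code for pairs of messages. -/
noncomputable def TwoStreamCode.joint (C : TwoStreamCode ν N) : Code ν N where
  M := C.MH * C.ML
  two_le := by have := C.two_le_MH; have := C.two_le_ML; nlinarith
  enc m := C.enc (finProdFinEquiv.symm m).1 (finProdFinEquiv.symm m).2
  dec h y := finProdFinEquiv (C.decH h y, C.decL h y)
  measurable_dec := (measurable_of_finite _).comp (C.measurable_decH.prodMk C.measurable_decL)

namespace TwoStreamCode

variable (C : TwoStreamCode ν N)

theorem rate_joint : C.joint.rate = C.rateH + C.rateL := by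
  have h1 : (C.MH : ℝ) ≠ 0 := by have := C.two_le_MH; positivity
  have h2 : (C.ML : ℝ) ≠ 0 := by have := C.two_le_ML; positivity
  simp only [Code.rate, rateH, rateL, joint, Nat.cast_mul]
  rw [Real.log_mul h1 h2, add_div]

theorem powerLE_joint {ρ : ℝ} (h : C.PowerLE ρ) : C.joint.PowerLE ρ := by
  have : ∑ m, energy (C.joint.enc m) = ∑ i, ∑ j, energy (C.enc i j) := by
    rw [← Fintype.sum_prod_type']
    exact Equiv.sum_comp finProdFinEquiv.symm fun p => energy (C.enc p.1 p.2)
  have hM : (C.joint.M : ℝ) = C.MH * C.ML := by simp [joint]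
  rw [Code.PowerLE, this, hM]
  exact h

theorem SymbolPowerLE.powerLE {C : TwoStreamCode ν N} {ρ : ℝ} (h : C.SymbolPowerLE ρ) :
    C.PowerLE ρ := by
  have h1 : ∑ i, ∑ j, energy (C.enc i j) = ∑ n, ∑ i, ∑ j, ‖C.enc i j n‖ ^ 2 := by
    simp only [energy]
    rw [Finset.sum_comm]
    rw [Finset.sum_comm, Finset.sum_congr rfl fun i _ => Finset.sum_comm, Finset.sum_comm]
  rw [PowerLE, h1, Finset.sum_div]
  exact (Finset.sum_le_card_nsmul _ _ ρ fun n _ => h n).trans_eq (by simp)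

theorem err_joint_le : C.joint.err ≤ C.errH + C.errL := by
  rw [Code.err, errH, errL, ← ENNReal.add_div]
  have h1 : ((C.joint.M : ℕ) : ℝ≥0∞) = C.MH * C.ML := by simp [joint]
  rw [h1]
  gcongr
  have h2 : ∑ m, channelLaw ν N {ω | C.joint.dec ω.1 (received (C.joint.enc m) ω) ≠ m} =
      ∑ i, ∑ j, channelLaw ν N {ω | finProdFinEquiv (C.decH ω.1 (received (C.enc i j) ω),
        C.decL ω.1 (received (C.enc i j) ω)) ≠ finProdFinEquiv (i, j)} := by
    rw [← Fintype.sum_prod_type']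
    refine (Equiv.sum_comp finProdFinEquiv _).symm.trans (Finset.sum_congr rfl fun p _ => ?_)
    simp [joint]
  rw [h2]
  simp only [← Finset.sum_add_distrib]
  refine Finset.sum_le_sum fun i _ => Finset.sum_le_sum fun j _ => ?_
  refine (measure_mono fun ω hω => ?_).trans (measure_union_le _ _)
  by_contra hc
  simp only [Set.mem_union, not_or] at hc
  have h3 := not_not.1 hc.1
  have h4 := not_not.1 hc.2
  refine hω ?_
  rw [h3, h4]

end TwoStreamCode

end Converse

/-! ### Superposed QAM with successive minimum-distance decoding. -/

section QAM

/-- Minimum-distance decoders must be measurable, so ties are broken by adding the candidates one at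
a time. -/
theorem exists_measurable_argmin {α ι : Type*} [MeasurableSpace α] [Fintype ι] [Nonempty ι]
    [MeasurableSpace ι] [MeasurableSingletonClass ι] (f : ι → α → ℝ) (hf : ∀ i, Measurable (f i)) :
    ∃ g : α → ι, Measurable g ∧ ∀ a i, f (g a) a ≤ f i a := by
  classical
  suffices h : ∀ s : Finset ι, s.Nonempty →
      ∃ g : α → ι, Measurable g ∧ ∀ a, ∀ i ∈ s, f (g a) a ≤ f i a by
    obtain ⟨g, hg, hmin⟩ := h Finset.univ Finset.univ_nonempty
    exact ⟨g, hg, fun a i => hmin a i (Finset.mem_univ i)⟩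
  intro s hs
  induction hs using Finset.Nonempty.cons_induction with
  | singleton i => exact ⟨fun _ => i, measurable_const, by simp⟩
  | cons j s hj hs ih =>
    obtain ⟨g, hg, hmin⟩ := ih
    have hF : Measurable fun p : ι × α => f p.1 p.2 := measurable_from_prod_countable_right hf
    have hfg : Measurable fun a => f (g a) a := hF.comp (hg.prodMk measurable_id)
    refine ⟨fun a => if f j a ≤ f (g a) a then j else g a,
      Measurable.ite (measurableSet_le (hf j) hfg) measurable_const hg, fun a i hi => ?_⟩
    rcases Finset.mem_cons.1 hi with rfl | hi
    · dsimp only; split_ifs with h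
      · exact le_rfl
      · exact (not_le.1 h).le
    · dsimp only; split_ifs with h
      · exact h.trans (hmin a i hi)
      · exact hmin a i hi

variable {ν N : ℕ}

theorem norm_qamPoint_le {K : ℕ} {a : ℝ} (ha : 0 ≤ a) (p : Fin K × Fin K) :
    ‖qamPoint K a p‖ ≤ 2 * (a * K) := by
  have h : ∀ q : Fin K, ‖((2 * (q.val : ℝ) - (K - 1) : ℝ) : ℂ)‖ ≤ K := fun q => by
    have h1 : (q.val : ℝ) + 1 ≤ K := by exact_mod_cast q.isLt
    have h2 : (0 : ℝ) ≤ q.val := by positivity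
    rw [Complex.norm_real, Real.norm_eq_abs, abs_le]
    constructor <;> linarith
  rw [qamPoint, norm_mul, Complex.norm_real, Real.norm_of_nonneg ha]
  have h3 := norm_add_le ((2 * (p.1.val : ℝ) - (K - 1) : ℝ) : ℂ)
    (((2 * (p.2.val : ℝ) - (K - 1) : ℝ) : ℂ) * Complex.I)
  rw [norm_mul, Complex.norm_I, mul_one] at h3
  nlinarith [h p.1, h p.2]

theorem two_mul_le_norm_qamPoint_sub {K : ℕ} {a : ℝ} (ha : 0 ≤ a) {p q : Fin K × Fin K}
    (hpq : p ≠ q) : 2 * a ≤ ‖qamPoint K a p - qamPoint K a q‖ := by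
  have h : ∀ i j : Fin K, i ≠ j → 2 * a ≤ |a * (2 * i.val - (K - 1)) - a * (2 * j.val - (K - 1))| := by
    intro i j hij
    have h1 : (1 : ℝ) ≤ |(i.val : ℝ) - j.val| := by
      have h2 : (i.val : ℤ) - j.val ≠ 0 := sub_ne_zero.2 (by exact_mod_cast Fin.val_ne_of_ne hij)
      exact_mod_cast Int.one_le_abs h2
    have h3 : a * (2 * i.val - (K - 1)) - a * (2 * j.val - (K - 1)) =
        2 * a * ((i.val : ℝ) - j.val) := by ring
    rw [h3, abs_mul, abs_of_nonneg (by positivity)]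
    nlinarith
  by_cases h1 : p.1 = q.1
  · have h2 : p.2 ≠ q.2 := fun h2 => hpq (Prod.ext h1 h2)
    refine (h _ _ h2).trans (le_trans (le_of_eq ?_) (Complex.abs_im_le_norm _))
    simp [qamPoint]
  · refine (h _ _ h1).trans (le_trans (le_of_eq ?_) (Complex.abs_re_le_norm _))
    simp [qamPoint]

theorem isZeroPadded_qamBlock (K : ℕ) (a : ℝ) (s : Fin N → Fin K × Fin K) :
    IsZeroPadded (qamBlock ν N K a s) := fun _ hn => dif_neg (not_lt.2 hn)

theorem IsZeroPadded.sub {x y : Block ν N} (hx : IsZeroPadded x) (hy : IsZeroPadded y) :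
    IsZeroPadded (x - y) := fun n hn => by rw [Pi.sub_apply, hx n hn, hy n hn, sub_zero]

theorem norm_qamBlock_apply_le {K : ℕ} {a : ℝ} (ha : 0 ≤ a) (s : Fin N → Fin K × Fin K)
    (n : Fin (N + ν)) : ‖qamBlock ν N K a s n‖ ≤ 2 * (a * K) := by
  rw [qamBlock]
  split_ifs
  · exact norm_qamPoint_le ha _
  · simp; positivity

theorem norm_qamBlock_le {K : ℕ} {a : ℝ} (ha : 0 ≤ a) (s : Fin N → Fin K × Fin K) :
    ‖qamBlock ν N K a s‖ ≤ 2 * (a * K) :=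
  (pi_norm_le_iff_of_nonneg (by positivity)).2 (norm_qamBlock_apply_le ha s)

theorem two_mul_le_norm_qamBlock_sub {K : ℕ} {a : ℝ} (ha : 0 ≤ a) {s s' : Fin N → Fin K × Fin K}
    (h : s ≠ s') : 2 * a ≤ ‖qamBlock ν N K a s - qamBlock ν N K a s'‖ := by
  obtain ⟨n, hn⟩ := Function.ne_iff.1 h
  refine le_trans ?_ (norm_le_pi_norm _ ⟨n.val, by omega⟩)
  simpa [qamBlock] using two_mul_le_norm_qamPoint_sub ha hn

/-- Superposition of QAM layers with given sizes and scalings, decoded successively. -/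
def TwoStreamCode.IsQAM (C : TwoStreamCode ν N) (KH KL : ℕ) (aH aL : ℝ)
    (eH : Fin C.MH ≃ (Fin N → Fin KH × Fin KH)) (eL : Fin C.ML ≃ (Fin N → Fin KL × Fin KL)) : Prop :=
  (∀ i j, C.enc i j = qamBlock ν N KH aH (eH i) + qamBlock ν N KL aL (eL j)) ∧
  (∀ h y i, energy (y - convolve h (qamBlock ν N KH aH (eH (C.decH h y)))) ≤
    energy (y - convolve h (qamBlock ν N KH aH (eH i)))) ∧
  (∀ h y j,
    energy (y - convolve h (qamBlock ν N KH aH (eH (C.decH h y)))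
      - convolve h (qamBlock ν N KL aL (eL (C.decL h y)))) ≤
    energy (y - convolve h (qamBlock ν N KH aH (eH (C.decH h y)))
      - convolve h (qamBlock ν N KL aL (eL j))))

theorem exists_isQAM (hN : 1 ≤ N) {KH KL : ℕ} (hKH : 2 ≤ KH) (hKL : 2 ≤ KL) (aH aL : ℝ) :
    ∃ (C : TwoStreamCode ν N) (eH : Fin C.MH ≃ (Fin N → Fin KH × Fin KH))
      (eL : Fin C.ML ≃ (Fin N → Fin KL × Fin KL)), C.IsQAM KH KL aH aL eH eL := by
  have hcard : ∀ K : ℕ, 2 ≤ K → 2 ≤ Fintype.card (Fin N → Fin K × Fin K) := fun K hK => by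
    simp only [Fintype.card_fun, Fintype.card_prod, Fintype.card_fin]
    calc 2 ≤ K * K := by nlinarith
      _ = (K * K) ^ 1 := (pow_one _).symm
      _ ≤ (K * K) ^ N := Nat.pow_le_pow_right (by positivity) hN
  have : NeZero (Fintype.card (Fin N → Fin KH × Fin KH)) := ⟨by have := hcard KH hKH; omega⟩
  have : NeZero (Fintype.card (Fin N → Fin KL × Fin KL)) := ⟨by have := hcard KL hKL; omega⟩
  let eH := (Fintype.equivFin (Fin N → Fin KH × Fin KH)).symm
  let eL := (Fintype.equivFin (Fin N → Fin KL × Fin KL)).symm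
  let fH : Fin _ → Taps ν × Block ν N → Block ν N :=
    fun i p => p.2 - convolve p.1 (qamBlock ν N KH aH (eH i))
  have hfH : ∀ i, Measurable (fH i) := fun i =>
    measurable_snd.sub ((measurable_convolve _).comp measurable_fst)
  obtain ⟨gH, hgH, hminH⟩ := exists_measurable_argmin (fun i p => energy (fH i p)) fun i =>
    continuous_energy.measurable.comp (hfH i)
  let fL : Fin _ → Taps ν × Block ν N → Block ν N :=
    fun j p => fH (gH p) p - convolve p.1 (qamBlock ν N KL aL (eL j))
  have hfL : ∀ j, Measurable (fL j) := fun j => by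
    have hF : Measurable fun q : Fin _ × (Taps ν × Block ν N) => fH q.1 q.2 :=
      measurable_from_prod_countable_right hfH
    exact (hF.comp (hgH.prodMk measurable_id)).sub ((measurable_convolve _).comp measurable_fst)
  obtain ⟨gL, hgL, hminL⟩ := exists_measurable_argmin (fun j p => energy (fL j p)) fun j =>
    continuous_energy.measurable.comp (hfL j)
  exact ⟨⟨_, _, hcard KH hKH, hcard KL hKL,
    fun i j => qamBlock ν N KH aH (eH i) + qamBlock ν N KL aL (eL j),
    fun h y => gH (h, y), fun h y => gL (h, y), hgH, hgL⟩, eH, eL, fun _ _ => rfl,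
    fun h y i => hminH (h, y) i, fun h y j => hminL (h, y) j⟩

/-- Error of minimum-distance decoding forces the disturbance to be large. -/
theorem norm_convolve_sub_le_of_energy_le {h : Taps ν} {y x x' : Block ν N}
    (he : energy (y - convolve h x') ≤ energy (y - convolve h x)) :
    ‖convolve h (x - x')‖ ≤ (1 + √(N + ν)) * ‖y - convolve h x‖ := by
  have h1 : ‖y - convolve h x'‖ ≤ √(N + ν) * ‖y - convolve h x‖ := by
    rw [← Real.sqrt_sq (norm_nonneg (y - convolve h x)), ← Real.sqrt_mul (by positivity)]
    exact Real.le_sqrt_of_sq_le ((sq_norm_le_energy _).trans (he.trans (energy_le _)))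
  have h2 : convolve h (x - x') = (y - convolve h x') - (y - convolve h x) := by
    rw [convolve_sub]; abel
  rw [h2]
  linarith [norm_sub_le (y - convolve h x') (y - convolve h x)]

/-- For fixed noise `z` the taps must lie in a ball of radius `‖z‖ / a`, of probability at most `(4
‖z‖ ^ 2 / a ^ 2) ^ (ν + 1)`; the noise has a finite moment of order `2 (ν + 1)`. -/
theorem exists_outage_le (ν N : ℕ) : ∃ K : ℝ, 0 ≤ K ∧ ∀ a : ℝ, 0 < a →
    channelLaw ν N {ω | a * ‖ω.1‖ ≤ ‖ω.2‖} ≤ ENNReal.ofReal (K * ((a ^ 2) ^ (ν + 1))⁻¹) := by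
  set P := Measure.pi fun _ : Fin (N + ν) => stdComplexGaussian with hP
  set I : ℝ≥0∞ := ∫⁻ z, ENNReal.ofReal (‖z‖ ^ (2 * (ν + 1))) ∂P with hI
  have hIt : I < ∞ := lintegral_norm_pow_pi_lt_top (by omega)
  refine ⟨4 ^ (ν + 1) * I.toReal, by positivity, fun a ha => ?_⟩
  have hm : MeasurableSet {ω : Taps ν × Block ν N | a * ‖ω.1‖ ≤ ‖ω.2‖} :=
    measurableSet_le (by fun_prop) (by fun_prop)
  rw [channelLaw, Measure.prod_apply_symm hm]
  calc ∫⁻ z, (Measure.pi fun _ : Fin (ν + 1) => stdComplexGaussian)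
        ((fun h => (h, z)) ⁻¹' {ω : Taps ν × Block ν N | a * ‖ω.1‖ ≤ ‖ω.2‖}) ∂P
      ≤ ∫⁻ z, ENNReal.ofReal (4 ^ (ν + 1) * ((a ^ 2) ^ (ν + 1))⁻¹) *
          ENNReal.ofReal (‖z‖ ^ (2 * (ν + 1))) ∂P := by
        refine lintegral_mono fun z => ?_
        have hsub : (fun h => (h, z)) ⁻¹' {ω : Taps ν × Block ν N | a * ‖ω.1‖ ≤ ‖ω.2‖} ⊆
            Metric.closedBall 0 (‖z‖ / a) := fun h hh => by
          rw [mem_closedBall_zero_iff, le_div_iff₀' ha]; exact hh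
        refine (measure_mono hsub).trans ((pi_stdComplexGaussian_closedBall_le (by positivity)).trans_eq ?_)
        rw [← ENNReal.ofReal_mul (by positivity), Fintype.card_fin]
        congr 1
        rw [div_pow, mul_pow, div_pow, pow_mul]
        ring
    _ = ENNReal.ofReal (4 ^ (ν + 1) * ((a ^ 2) ^ (ν + 1))⁻¹) * I :=
        lintegral_const_mul _ (by fun_prop)
    _ = ENNReal.ofReal (4 ^ (ν + 1) * I.toReal * ((a ^ 2) ^ (ν + 1))⁻¹) := by
        rw [← ENNReal.ofReal_toReal hIt.ne, ← ENNReal.ofReal_mul (by positivity),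
          ENNReal.ofReal_toReal hIt.ne]
        congr 1; ring

theorem sum_sum_div_le {A B : ℕ} {f : Fin A → Fin B → ℝ≥0∞} {x : ℝ≥0∞}
    (h : ∀ i j, f i j ≤ x) : (∑ i, ∑ j, f i j) / (A * B) ≤ x := by
  refine ENNReal.div_le_of_le_mul ?_
  refine (Finset.sum_le_sum fun i _ => Finset.sum_le_sum fun j _ => h i j).trans_eq ?_
  simp; ring

/-- An error in either layer is contained in an event where `‖h‖` times the spacing is at most a
multiple of `‖z‖`. For the high layer the interference is proportional to `‖h‖` too, so a small `κ`
absorbs it into the separation of the words. -/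
theorem exists_err_isQAM_le (ν N : ℕ) : ∃ κ K : ℝ, 0 < κ ∧ κ ≤ 1 ∧ 0 ≤ K ∧
    ∀ (C : TwoStreamCode ν N) (KH KL : ℕ) (aH aL : ℝ) (eH : Fin C.MH ≃ (Fin N → Fin KH × Fin KH))
      (eL : Fin C.ML ≃ (Fin N → Fin KL × Fin KL)), C.IsQAM KH KL aH aL eH eL →
      0 < aH → 0 < aL → aL ≤ aH → aL * KL ≤ κ * aH →
      C.errH ≤ ENNReal.ofReal (K * ((aH ^ 2) ^ (ν + 1))⁻¹) ∧
      C.errL ≤ ENNReal.ofReal (K * ((aL ^ 2) ^ (ν + 1))⁻¹) := by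
  obtain ⟨c, hc, hconv⟩ := exists_le_norm_convolve ν N
  obtain ⟨K, hK, hout⟩ := exists_outage_le ν N
  set s : ℝ := 1 + √(N + ν) with hs
  have hs0 : 0 < s := by positivity
  -- Minimum distance `2 * aH` yields separation `2 c aH ‖h‖`; this `κ` lets the interference use up
  -- at most half of it.
  refine ⟨min 1 (c / (2 * s * (ν + 1))), K * (((c / s) ^ 2) ^ (ν + 1))⁻¹, by positivity,
    min_le_left _ _, by positivity, ?_⟩
  intro C KH KL aH aL eH eL ⟨henc, hdecH, hdecL⟩ haH haL hle hκ
  have hκ' : 2 * s * (ν + 1) * (aL * KL) ≤ c * aH := by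
    have h1 : aL * KL ≤ c / (2 * s * (ν + 1)) * aH :=
      hκ.trans (mul_le_mul_of_nonneg_right (min_le_right _ _) haH.le)
    calc 2 * s * (ν + 1) * (aL * KL) ≤ 2 * s * (ν + 1) * (c / (2 * s * (ν + 1)) * aH) := by gcongr
      _ = c * aH := by field_simp
  have hset : ∀ a, 0 < a → channelLaw ν N {ω | c * a * ‖ω.1‖ ≤ s * ‖ω.2‖} ≤
      ENNReal.ofReal (K * (((c / s) ^ 2) ^ (ν + 1))⁻¹ * ((a ^ 2) ^ (ν + 1))⁻¹) := by
    intro a ha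
    have h1 : {ω : Taps ν × Block ν N | c * a * ‖ω.1‖ ≤ s * ‖ω.2‖} =
        {ω | c / s * a * ‖ω.1‖ ≤ ‖ω.2‖} := by
      ext ω
      change c * a * ‖ω.1‖ ≤ s * ‖ω.2‖ ↔ c / s * a * ‖ω.1‖ ≤ ‖ω.2‖
      rw [← div_le_iff₀' hs0]
      have : c * a * ‖ω.1‖ / s = c / s * a * ‖ω.1‖ := by ring
      rw [this]
    rw [h1]
    refine (hout _ (by positivity)).trans_eq ?_
    congr 1
    rw [mul_pow, mul_pow, mul_inv]; ring
  have hH : ∀ i j (ω : Taps ν × Block ν N), C.decH ω.1 (received (C.enc i j) ω) ≠ i →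
      c * aH * ‖ω.1‖ ≤ s * ‖ω.2‖ := by
    intro i j ω hne
    have h1 := norm_convolve_sub_le_of_energy_le (hdecH ω.1 (received (C.enc i j) ω) i)
    have h2 := hconv ω.1 _ ((isZeroPadded_qamBlock KH aH (eH i)).sub
      (isZeroPadded_qamBlock KH aH (eH (C.decH ω.1 (received (C.enc i j) ω)))))
    have h3 := two_mul_le_norm_qamBlock_sub (ν := ν) haH.le (eH.injective.ne hne.symm)
    have h4 : received (C.enc i j) ω - convolve ω.1 (qamBlock ν N KH aH (eH i)) =
        convolve ω.1 (qamBlock ν N KL aL (eL j)) + ω.2 := by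
      rw [received, henc, convolve_add]; abel
    rw [h4] at h1
    have h5 : ‖convolve ω.1 (qamBlock ν N KL aL (eL j)) + ω.2‖ ≤
        (ν + 1) * ‖ω.1‖ * (2 * (aL * KL)) + ‖ω.2‖ := by
      refine (norm_add_le _ _).trans ?_
      gcongr
      refine (norm_convolve_le _ _).trans ?_
      gcongr
      exact norm_qamBlock_le haL.le _
    have h6 : c * ‖ω.1‖ * (2 * aH) ≤ s * ((ν + 1) * ‖ω.1‖ * (2 * (aL * KL)) + ‖ω.2‖) :=
      calc c * ‖ω.1‖ * (2 * aH) ≤ c * ‖ω.1‖ * _ := by gcongr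
        _ ≤ _ := h2
        _ ≤ _ := h1
        _ ≤ _ := by gcongr
    have h7 := mul_le_mul_of_nonneg_right hκ' (norm_nonneg ω.1)
    linarith
  have hL : ∀ i j (ω : Taps ν × Block ν N), C.decL ω.1 (received (C.enc i j) ω) ≠ j →
      c * aL * ‖ω.1‖ ≤ s * ‖ω.2‖ := by
    -- Error propagation costs nothing: a wrong high decision already forces `c * aH * ‖h‖ ≤ s *
    -- ‖z‖`, which is stronger than the claim because `aL ≤ aH`.
    intro i j ω hne
    by_cases hi : C.decH ω.1 (received (C.enc i j) ω) = i
    · have h0 := hdecL ω.1 (received (C.enc i j) ω) j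
      rw [hi] at h0
      have h1 := norm_convolve_sub_le_of_energy_le h0
      have h2 := hconv ω.1 _ ((isZeroPadded_qamBlock KL aL (eL j)).sub
        (isZeroPadded_qamBlock KL aL (eL (C.decL ω.1 (received (C.enc i j) ω)))))
      have h3 := two_mul_le_norm_qamBlock_sub (ν := ν) haL.le (eL.injective.ne hne.symm)
      have h4 : received (C.enc i j) ω - convolve ω.1 (qamBlock ν N KH aH (eH i)) -
          convolve ω.1 (qamBlock ν N KL aL (eL j)) = ω.2 := by
        rw [received, henc, convolve_add]; abel
      rw [h4] at h1
      have h6 : c * ‖ω.1‖ * (2 * aL) ≤ s * ‖ω.2‖ :=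
        calc c * ‖ω.1‖ * (2 * aL) ≤ c * ‖ω.1‖ * _ := by gcongr
          _ ≤ _ := h2
          _ ≤ _ := h1
      have : 0 ≤ c * aL * ‖ω.1‖ := by positivity
      linarith
    · refine le_trans ?_ (hH i j ω hi)
      gcongr
  constructor
  · exact sum_sum_div_le fun i j => (measure_mono fun ω hω => hH i j ω hω).trans (hset _ haH)
  · exact sum_sum_div_le fun i j => (measure_mono fun ω hω => hL i j ω hω).trans (hset _ haL)

end QAM

/-! ### Choice of constellation sizes and powers as functions of the SNR. -/

section Family

variable {ν N : ℕ}

/-- Number of amplitudes per real dimension of a QAM constellation with about `ρ ^ α` points. -/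
noncomputable def qamSize (α ρ : ℝ) : ℕ := ⌊ρ ^ (α / 2)⌋₊ + 2

theorem rpow_le_qamSize (α ρ : ℝ) : ρ ^ (α / 2) ≤ qamSize α ρ := by
  have := Nat.lt_floor_add_one (ρ ^ (α / 2))
  rw [qamSize]; push_cast; linarith

theorem qamSize_le {α ρ : ℝ} (hα : 0 ≤ α) (hρ : 1 ≤ ρ) : qamSize α ρ ≤ 3 * ρ ^ (α / 2) := by
  have h1 : 1 ≤ ρ ^ (α / 2) := Real.one_le_rpow hρ (by positivity)
  have := Nat.floor_le (zero_le_one.trans h1)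
  rw [qamSize]; push_cast; linarith

theorem tendsto_log_qamSize {α : ℝ} (hα : 0 ≤ α) :
    Tendsto (fun ρ => Real.log (qamSize α ρ) / Real.log ρ) atTop (𝓝 (α / 2)) := by
  have h1 : Tendsto (fun ρ : ℝ => Real.log 3 / Real.log ρ + α / 2) atTop (𝓝 (α / 2)) := by
    simpa using (Real.tendsto_log_atTop.const_div_atTop (Real.log 3)).add_const (α / 2)
  refine tendsto_of_tendsto_of_tendsto_of_le_of_le' tendsto_const_nhds h1 ?_ ?_
  · filter_upwards [eventually_gt_atTop 1] with ρ hρ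
    have h0 : 0 < ρ := by linarith
    rw [le_div_iff₀ (Real.log_pos hρ), ← Real.log_rpow h0]
    exact Real.log_le_log (by positivity) (rpow_le_qamSize α ρ)
  · filter_upwards [eventually_gt_atTop 1] with ρ hρ
    have h0 : 0 < ρ := by linarith
    have hl := Real.log_pos hρ
    rw [div_le_iff₀ hl, add_mul, div_mul_cancel₀ _ hl.ne', ← Real.log_rpow h0,
      ← Real.log_mul (by norm_num) (by positivity)]
    refine Real.log_le_log ?_ (qamSize_le hα hρ.le)
    rw [qamSize]; positivity

/-- Only `N` of the `N + ν` instants carry symbols, so each symbol needs about `ρ ^ ((N + ν) r / N)`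
points. This is the origin of the factor `(N + ν) / N` in the lower bound. -/
theorem hasMultiplexing_qam (hN : 1 ≤ N) {r : ℝ} (hr : 0 ≤ r) {M : ℝ → ℕ}
    (e : ∀ ρ, Fin (M ρ) ≃ (Fin N → Fin (qamSize ((N + ν) / N * r) ρ) × Fin (qamSize ((N + ν) / N * r) ρ))) :
    HasMultiplexing (fun ρ => Real.log (M ρ) / (N + ν)) r := by
  have hN' : (0 : ℝ) < N := by exact_mod_cast hN
  have h1 := (tendsto_log_qamSize (α := (N + ν) / N * r) (by positivity)).const_mul
    (2 * N / (N + ν) : ℝ)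
  have h2 : 2 * N / (N + ν) * ((N + ν) / N * r / 2) = r := by field_simp
  rw [h2] at h1
  refine h1.congr fun ρ => ?_
  have h3 : M ρ = (qamSize ((N + ν) / N * r) ρ * qamSize ((N + ν) / N * r) ρ) ^ N := by
    simpa using Fintype.card_congr (e ρ)
  dsimp only
  rw [h3]
  push_cast
  rw [Real.log_pow, ← sq, Real.log_pow]
  push_cast
  ring

theorem mul_inv_pow_le {K b s a ρ : ℝ} (hK : 0 ≤ K) (hb : 0 < b) (hρ : 0 < ρ) (m : ℕ)
    (h : b * ρ ^ (s / 2) ≤ a) :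
    K * ((a ^ 2) ^ (m + 1))⁻¹ ≤ K * ((b ^ 2) ^ (m + 1))⁻¹ * ρ ^ (-((m + 1) * s)) := by
  have h1 : ((b * ρ ^ (s / 2)) ^ 2) ^ (m + 1) = (b ^ 2) ^ (m + 1) * ρ ^ ((m + 1) * s) := by
    rw [mul_pow, mul_pow, ← pow_mul (ρ ^ _), ← Real.rpow_natCast (ρ ^ _), ← Real.rpow_mul hρ.le]
    congr 2; push_cast; ring
  rw [mul_assoc, Real.rpow_neg hρ.le, ← mul_inv, ← h1]
  gcongr

theorem exists_qam_family (ν N : ℕ) (hN : 1 ≤ N) {rH rL : ℝ} (hrH : 0 ≤ rH) (hrL : 0 ≤ rL)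
    (hr : (N + ν) * (rH + rL) ≤ N) : ∃ (C : ℝ → TwoStreamCode ν N) (K : ℝ),
      (∀ᶠ ρ in atTop, (C ρ).IsUncodedQAMSuccessive ∧ (C ρ).SymbolPowerLE ρ) ∧
      (∀ ρ i j, IsZeroPadded ((C ρ).enc i j)) ∧
      HasMultiplexing (fun ρ => (C ρ).rateH) rH ∧ HasMultiplexing (fun ρ => (C ρ).rateL) rL ∧
      DecaysAtMost (fun ρ => (C ρ).errH) ((ν + 1) * (1 - (N + ν) / N * rH)) ∧
      DecaysAtMost (fun ρ => (C ρ).errL) ((ν + 1) * (1 - (N + ν) / N * (rH + rL))) ∧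
      (∀ᶠ ρ in atTop, (C ρ).errH ≤
        ENNReal.ofReal (K * ρ ^ (-((ν + 1) * (1 - (N + ν) / N * rH))))) ∧
      (∀ᶠ ρ in atTop, (C ρ).errL ≤
        ENNReal.ofReal (K * ρ ^ (-((ν + 1) * (1 - (N + ν) / N * (rH + rL)))))) := by
  obtain ⟨κ, K, hκ, hκ1, hK, herr⟩ := exists_err_isQAM_le ν N
  have hN' : (0 : ℝ) < N := by exact_mod_cast hN
  set α : ℝ := (N + ν) / N * rH with hα
  set β : ℝ := (N + ν) / N * rL with hβ
  have hα0 : 0 ≤ α := by positivity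
  have hβ0 : 0 ≤ β := by positivity
  have hαβ : (N + ν) / N * (rH + rL) = α + β := mul_add _ _ _
  have hαβ1 : α + β ≤ 1 := by
    rw [← hαβ, div_mul_eq_mul_div, div_le_one hN']; exact hr
  let KH : ℝ → ℕ := qamSize α
  let KL : ℝ → ℕ := qamSize β
  -- Each layer has amplitude at most `2 * a * K`, which is at most `ρ ^ (1 / 2) / 2`; the power
  -- constraint even holds for every word at every instant.
  let aH : ℝ → ℝ := fun ρ => ρ ^ (1 / 2 : ℝ) / (4 * KH ρ)
  let aL : ℝ → ℝ := fun ρ => κ * aH ρ / KL ρ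
  -- The summand 2 in `qamSize` guarantees at least two messages for every `ρ`, including at
  -- multiplexing rate zero.
  have hKH : ∀ ρ, 2 ≤ KH ρ := fun ρ => Nat.le_add_left _ _
  have hKL : ∀ ρ, 2 ≤ KL ρ := fun ρ => Nat.le_add_left _ _
  have hKH0 : ∀ ρ, (0 : ℝ) < KH ρ := fun ρ => by have := hKH ρ; positivity
  have hKL0 : ∀ ρ, (0 : ℝ) < KL ρ := fun ρ => by have := hKL ρ; positivity
  have hKL1 : ∀ ρ, (1 : ℝ) ≤ KL ρ := fun ρ => by have := hKL ρ; exact_mod_cast (by omega : 1 ≤ KL ρ)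
  choose C eH eL hQ using fun ρ => exists_isQAM (ν := ν) hN (hKH ρ) (hKL ρ) (aH ρ) (aL ρ)
  have haH : ∀ ρ, 0 < ρ → 0 < aH ρ := fun ρ hρ => div_pos (by positivity) (by have := hKH0 ρ; positivity)
  have haL : ∀ ρ, 0 < ρ → 0 < aL ρ := fun ρ hρ => div_pos (mul_pos hκ (haH ρ hρ)) (hKL0 ρ)
  have hHK : ∀ ρ, aH ρ * KH ρ = ρ ^ (1 / 2 : ℝ) / 4 := fun ρ => by
    have := (hKH0 ρ).ne'
    simp only [aH]; field_simp
  have hLK : ∀ ρ, aL ρ * KL ρ = κ * aH ρ := fun ρ => by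
    have := (hKL0 ρ).ne'
    simp only [aL]; field_simp
  have hle : ∀ ρ, 0 < ρ → aL ρ ≤ aH ρ := fun ρ hρ => by
    have := haH ρ hρ
    have := haL ρ hρ
    have := hLK ρ
    have := hKL1 ρ
    nlinarith
  have hLH : ∀ ρ, 0 < ρ → aL ρ * KL ρ ≤ ρ ^ (1 / 2 : ℝ) / 4 := fun ρ hρ => by
    have h1 := haH ρ hρ
    have h2 : (1 : ℝ) ≤ KH ρ := by have := hKH ρ; exact_mod_cast (by omega : 1 ≤ KH ρ)
    rw [hLK, ← hHK]
    nlinarith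
  have haH_ge' : ∀ ρ, 1 ≤ ρ → 1 / 12 * ρ ^ ((1 - α) / 2) ≤ aH ρ := fun ρ hρ => by
    have h0 : 0 < ρ := by linarith
    have h1 := qamSize_le hα0 hρ
    have h2 : ρ ^ ((1 - α) / 2) * ρ ^ (α / 2) = ρ ^ (1 / 2 : ℝ) := by
      rw [← Real.rpow_add h0]; congr 1; ring
    rw [le_div_iff₀ (by have := hKH0 ρ; positivity), ← h2]
    calc 1 / 12 * ρ ^ ((1 - α) / 2) * (4 * KH ρ)
        ≤ 1 / 12 * ρ ^ ((1 - α) / 2) * (4 * (3 * ρ ^ (α / 2))) := by gcongr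
      _ = _ := by ring
  -- Weakened from 1/12 so that both layers share one constant.
  have haH_ge : ∀ ρ, 1 ≤ ρ → κ / 36 * ρ ^ ((1 - α) / 2) ≤ aH ρ := fun ρ hρ => by
    refine le_trans ?_ (haH_ge' ρ hρ)
    gcongr
    linarith
  have haL_ge : ∀ ρ, 1 ≤ ρ → κ / 36 * ρ ^ ((1 - (α + β)) / 2) ≤ aL ρ := fun ρ hρ => by
    have h0 : 0 < ρ := by linarith
    have h1 := qamSize_le hβ0 hρ
    have h2 : ρ ^ ((1 - (α + β)) / 2) * ρ ^ (β / 2) = ρ ^ ((1 - α) / 2) := by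
      rw [← Real.rpow_add h0]; congr 1; ring
    rw [le_div_iff₀ (hKL0 ρ)]
    calc κ / 36 * ρ ^ ((1 - (α + β)) / 2) * KL ρ
        ≤ κ / 36 * ρ ^ ((1 - (α + β)) / 2) * (3 * ρ ^ (β / 2)) := by gcongr
      _ = κ * (1 / 12 * ρ ^ ((1 - α) / 2)) := by rw [← h2]; ring
      _ ≤ κ * aH ρ := by gcongr; exact haH_ge' ρ hρ
  have henc : ∀ ρ i j, (C ρ).enc i j =
      qamBlock ν N (KH ρ) (aH ρ) (eH ρ i) + qamBlock ν N (KL ρ) (aL ρ) (eL ρ j) := fun ρ => (hQ ρ).1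
  have hzero : ∀ ρ i j, IsZeroPadded ((C ρ).enc i j) := fun ρ i j n hn => by
    rw [henc, Pi.add_apply, isZeroPadded_qamBlock _ _ _ n hn, isZeroPadded_qamBlock _ _ _ n hn,
      add_zero]
  have hML : ∀ ρ, (0 : ℝ) < (C ρ).ML := fun ρ => by have := (C ρ).two_le_ML; positivity
  have hMH : ∀ ρ, (0 : ℝ) < (C ρ).MH := fun ρ => by have := (C ρ).two_le_MH; positivity
  have hpow : ∀ ρ, 0 < ρ → (C ρ).SymbolPowerLE ρ := fun ρ hρ n => by
    rw [div_le_iff₀ (mul_pos (hMH ρ) (hML ρ))]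
    have h1 : ∀ i j, ‖(C ρ).enc i j n‖ ^ 2 ≤ ρ := fun i j => by
      have h2 : ‖(C ρ).enc i j n‖ ≤ ρ ^ (1 / 2 : ℝ) := by
        rw [henc, Pi.add_apply]
        refine (norm_add_le _ _).trans ?_
        have h3 := norm_qamBlock_apply_le (ν := ν) (haH ρ hρ).le (eH ρ i) n
        have h4 := norm_qamBlock_apply_le (ν := ν) (haL ρ hρ).le (eL ρ j) n
        have h5 := hHK ρ
        have h6 := hLH ρ hρ
        linarith
      calc ‖(C ρ).enc i j n‖ ^ 2 ≤ (ρ ^ (1 / 2 : ℝ)) ^ 2 := by gcongr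
        _ = ρ := by rw [← Real.rpow_natCast, ← Real.rpow_mul hρ.le]; norm_num
    refine (Finset.sum_le_sum fun i _ => Finset.sum_le_sum fun j _ => h1 i j).trans_eq ?_
    simp; ring
  have hrateH : HasMultiplexing (fun ρ => (C ρ).rateH) rH := hasMultiplexing_qam hN hrH eH
  have hrateL : HasMultiplexing (fun ρ => (C ρ).rateL) rL := hasMultiplexing_qam hN hrL eL
  rw [hαβ]
  refine ⟨C, K * (((κ / 36) ^ 2) ^ (ν + 1))⁻¹, ?_, hzero, hrateH, hrateL, ?_, ?_, ?_, ?_⟩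
  · filter_upwards [eventually_gt_atTop 0] with ρ hρ
    exact ⟨⟨KH ρ, KL ρ, aH ρ, aL ρ, eH ρ, eL ρ, haH ρ hρ, haL ρ hρ, hQ ρ⟩, hpow ρ hρ⟩
  · refine decaysAtMost_of_power (k := N) hN (by omega) hrH (by nlinarith) (fun ρ => (C ρ).MH)
      (fun ρ => (C ρ).ML) (fun ρ => (C ρ).enc) (fun ρ => (C ρ).decH)
      (fun ρ => (C ρ).measurable_decH) (fun ρ => (C ρ).two_le_MH)
      (fun ρ => by have := (C ρ).two_le_ML; omega) hrateH (.of_forall hzero) ?_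
    filter_upwards [eventually_gt_atTop 0] with ρ hρ
    exact (hpow ρ hρ).powerLE
  -- The streams trade places: for each high word, taken as the centre, the low words fill a box of
  -- side of order `aH`, that is `ρ ^ ((1 - α) / 2)`. The low layer thus behaves like a code with
  -- power `ρ ^ (1 - α)`, and its error cannot decay faster than claimed.
  · have h1 := decaysAtMost_of_box (k := N) (l := 1 - α) (θ := β) (C := 1) hN (by omega) hβ0
      (by linarith) one_pos.le (fun ρ => (C ρ).ML) (fun ρ => (C ρ).MH)
      (fun ρ j i => (C ρ).enc i j) (fun ρ => (C ρ).decL) (fun ρ => (C ρ).measurable_decL)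
      (.of_forall fun ρ => (C ρ).two_le_ML)
      (.of_forall fun ρ => by have := (C ρ).two_le_MH; omega) ?_ ?_
    · have h2 : (ν + 1) * (1 - α - β) = (ν + 1) * (1 - (α + β)) := by ring
      rw [h2] at h1
      refine h1.mono fun ρ => le_of_eq ?_
      rw [TwoStreamCode.errL, Finset.sum_comm, mul_comm ((C ρ).ML : ℝ≥0∞)]
    · intro s hs
      refine hrateL.eventually_rpow_le (by positivity)
        (.of_forall fun ρ => by have := (C ρ).two_le_ML; omega) ?_
      rwa [hβ, ← mul_assoc, mul_div_cancel₀ _ hN'.ne'] at hs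
    · filter_upwards [eventually_gt_atTop 0] with ρ hρ
      refine ⟨fun i => qamBlock ν N (KH ρ) (aH ρ) (eH ρ i), Finset.univ, ?_, fun p _ => ⟨?_, ?_⟩⟩
      · simp; omega
      · intro n hn
        rw [henc, Pi.add_apply, isZeroPadded_qamBlock (KL ρ) _ _ n hn, add_zero]
      · rw [henc, add_sub_cancel_left]
        refine (norm_qamBlock_le (haL ρ hρ).le _).trans ?_
        rw [hLK, one_mul]
        have h2 : aH ρ * ρ ^ (α / 2) ≤ ρ ^ ((1 - α) / 2) / 4 * ρ ^ (α / 2) := by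
          have h3 : ρ ^ ((1 - α) / 2) / 4 * ρ ^ (α / 2) = ρ ^ (1 / 2 : ℝ) / 4 := by
            rw [div_mul_eq_mul_div, ← Real.rpow_add hρ]; congr 2; ring
          rw [h3, ← hHK]
          exact mul_le_mul_of_nonneg_left (rpow_le_qamSize α ρ) (haH ρ hρ).le
        have h4 := le_of_mul_le_mul_right h2 (by positivity)
        have h5 := haH ρ hρ
        nlinarith
  · filter_upwards [eventually_ge_atTop 1] with ρ hρ
    have h0 : 0 < ρ := by linarith
    exact (herr _ _ _ _ _ _ _ (hQ ρ) (haH ρ h0) (haL ρ h0) (hle ρ h0) (hLK ρ).le).1.trans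
      (ENNReal.ofReal_le_ofReal (mul_inv_pow_le hK (by positivity) h0 ν (haH_ge ρ hρ)))
  · filter_upwards [eventually_ge_atTop 1] with ρ hρ
    have h0 : 0 < ρ := by linarith
    exact (herr _ _ _ _ _ _ _ (hQ ρ) (haH ρ h0) (haL ρ h0) (hle ρ h0) (hLK ρ).le).2.trans
      (ENNReal.ofReal_le_ofReal (mul_inv_pow_le hK (by positivity) h0 ν (haL_ge ρ hρ)))

end Family

/-! ### Single-stream tradeoffs and the main theorem. -/

section Tradeoff

variable {ν N : ℕ}

theorem HasMultiplexing.joint {C : ℝ → TwoStreamCode ν N} {rH rL : ℝ}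
    (hH : HasMultiplexing (fun ρ => (C ρ).rateH) rH) (hL : HasMultiplexing (fun ρ => (C ρ).rateL) rL) :
    HasMultiplexing (fun ρ => (C ρ).joint.rate) (rH + rL) := by
  refine (Tendsto.add hH hL).congr fun ρ => ?_
  dsimp only
  rw [TwoStreamCode.rate_joint, add_div]

/-- The supremum is attained by the superposed family with `rL = 0`, read as a single-stream code:
its low layer has constant size, so both layers have the same exponent. The converse with `k = N`
shows that nothing zero-padded does better. -/
theorem zeroPaddedTradeoff_eq (hN : 1 ≤ N) {r : ℝ} (hr0 : 0 ≤ r) (hr : (N + ν) * r ≤ N) :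
    zeroPaddedTradeoff ν N r = lowerBound ν N r := by
  have hconv : ∀ C : ℝ → Code ν N, (∀ᶠ ρ in atTop, (C ρ).PowerLE ρ ∧
      ∀ m, IsZeroPadded ((C ρ).enc m)) → HasMultiplexing (fun ρ => (C ρ).rate) r →
      DecaysAtMost (fun ρ => (C ρ).err) ((ν + 1) * (1 - (N + ν) / N * r)) := fun C hC hrate =>
    decaysAtMost_err hN (by omega) hr0 hr C hrate (hC.mono fun ρ h => h.2) (hC.mono fun ρ h => h.1)
  refine IsGreatest.csSup_eq ⟨?_, ?_⟩
  · obtain ⟨C, K, hC, hzero, hrH, hrL, -, -, herrH, herrL⟩ :=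
      exists_qam_family ν N hN hr0 le_rfl (by simpa using hr)
    rw [add_zero] at herrL
    have hC' : ∀ᶠ ρ in atTop, (C ρ).joint.PowerLE ρ ∧ ∀ m, IsZeroPadded ((C ρ).joint.enc m) :=
      hC.mono fun ρ h => ⟨(C ρ).powerLE_joint h.2.powerLE, fun m => hzero ρ _ _⟩
    have hrate : HasMultiplexing (fun ρ => (C ρ).joint.rate) r := by
      simpa using hrH.joint hrL
    refine ⟨fun ρ => (C ρ).joint, hC', hrate, (hconv _ hC' hrate).hasDiversity (C := 2 * K) ?_⟩
    filter_upwards [herrH, herrL] with ρ h1 h2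
    refine (C ρ).err_joint_le.trans ((add_le_add h1 h2).trans_eq ?_)
    rw [← two_mul, mul_assoc, ENNReal.ofReal_mul zero_le_two]
    simp
  · rintro d ⟨C, hC, hrate, hd⟩
    exact (hconv C hC hrate).le_of_hasDiversity hd

theorem zeroPaddedTradeoff_le_tradeoff (ν N : ℕ) (r : ℝ) :
    zeroPaddedTradeoff ν N r ≤ tradeoff ν N r :=
  sSup_le_sSup fun _ ⟨C, hC, hrate, hd⟩ => ⟨C, hC.mono fun _ h => h.1, hrate, hd⟩

theorem decaysAtMost_err_of_powerLE (hN : 1 ≤ N) {r : ℝ} (hr0 : 0 ≤ r) (hr1 : r ≤ 1)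
    {C : ℝ → Code ν N} (hpow : ∀ᶠ ρ in atTop, (C ρ).PowerLE ρ)
    (hrate : HasMultiplexing (fun ρ => (C ρ).rate) r) :
    DecaysAtMost (fun ρ => (C ρ).err) ((ν + 1) * (1 - r)) := by
  have hn : (0 : ℝ) < N + ν := by
    have : (1 : ℝ) ≤ N := by exact_mod_cast hN
    positivity
  have := decaysAtMost_err (k := N + ν) (by omega) le_rfl hr0 (by push_cast; nlinarith) C hrate
    (.of_forall fun ρ m n h => absurd n.isLt (by omega)) hpow
  push_cast at this
  rwa [div_self hn.ne', one_mul] at this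

theorem tradeoff_le_upperBound (hN : 1 ≤ N) {r : ℝ} (hr0 : 0 ≤ r) (hr1 : r ≤ 1) :
    tradeoff ν N r ≤ upperBound ν r := by
  refine sSup_le ?_
  rintro d ⟨C, hC, hrate, hd⟩
  exact (decaysAtMost_err_of_powerLE hN hr0 hr1 hC hrate).le_of_hasDiversity hd

theorem lowerBound_le_upperBound (hN : 1 ≤ N) {r : ℝ} (hr0 : 0 ≤ r) :
    lowerBound ν N r ≤ upperBound ν r := by
  have hN' : (0 : ℝ) < N := by exact_mod_cast hN
  have h1 : 1 * r ≤ (N + ν) / N * r := by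
    gcongr
    rw [one_le_div hN']
    linarith [Nat.cast_nonneg (α := ℝ) ν]
  refine EReal.coe_le_coe_iff.2 ?_
  gcongr
  linarith

theorem lowerBound_antitone (ν N : ℕ) : Antitone (lowerBound ν N) := fun r s h => by
  refine EReal.coe_le_coe_iff.2 ?_
  gcongr

end Tradeoff

end ISI

theorem theorem3 (ν N : ℕ) (hN : 1 ≤ N) (rH rL : ℝ) (hrH : 0 ≤ rH) (hrL : 0 ≤ rL)
    (hr : rH + rL ≤ (N : ℝ) / (N + ν)) :
    -- achievability, by superposed uncoded QAM layers with successive decoding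
    (∃ (C : ℝ → ISI.TwoStreamCode ν N) (dH dL : EReal),
      (∀ᶠ ρ in atTop, (C ρ).IsUncodedQAMSuccessive ∧ (C ρ).SymbolPowerLE ρ) ∧
      ISI.HasTuple C rH dH rL dL ∧ dL ≤ dH ∧
      (ISI.lowerBound ν N rH ≤ dH ∧ dH ≤ ISI.upperBound ν rH) ∧
      (ISI.lowerBound ν N (rH + rL) ≤ dL ∧ dL ≤ ISI.upperBound ν (rH + rL)) ∧
      dH = ISI.zeroPaddedTradeoff ν N rH ∧ dL = ISI.zeroPaddedTradeoff ν N (rH + rL)) ∧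
    -- the upper bounds hold for every two-stream scheme
    (∀ (C : ℝ → ISI.TwoStreamCode ν N) (dH dL : EReal),
      (∀ᶠ ρ in atTop, (C ρ).PowerLE ρ) → ISI.HasTuple C rH dH rL dL →
      dH ≤ ISI.upperBound ν rH ∧ (dL ≤ dH → dL ≤ ISI.upperBound ν (rH + rL))) ∧
    -- the single-stream tradeoff obeys the same bounds at `rH` and at `rH + rL`
    (ISI.lowerBound ν N rH ≤ ISI.tradeoff ν N rH ∧
      ISI.tradeoff ν N rH ≤ ISI.upperBound ν rH) ∧
    (ISI.lowerBound ν N (rH + rL) ≤ ISI.tradeoff ν N (rH + rL) ∧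
      ISI.tradeoff ν N (rH + rL) ≤ ISI.upperBound ν (rH + rL)) := by
  have hN' : (1 : ℝ) ≤ N := by exact_mod_cast hN
  have hν : (0 : ℝ) ≤ ν := Nat.cast_nonneg ν
  have hn : (0 : ℝ) < N + ν := by positivity
  have hr' : (N + ν) * (rH + rL) ≤ N := by rwa [le_div_iff₀' hn] at hr
  have hrH' : (N + ν) * rH ≤ N := by nlinarith
  have h1 : rH + rL ≤ 1 := hr.trans ((div_le_one hn).2 (by linarith))
  have hH1 : rH ≤ 1 := by linarith
  have h0 : 0 ≤ rH + rL := by positivity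
  refine ⟨?_, fun C dH dL hpow hC => ⟨?_, fun hle => ?_⟩, ⟨?_, ?_⟩, ⟨?_, ?_⟩⟩
  · obtain ⟨C, K, hC, -, hrateH, hrateL, hdH, hdL, herrH, herrL⟩ :=
      ISI.exists_qam_family ν N hN hrH hrL hr'
    exact ⟨C, ISI.lowerBound ν N rH, ISI.lowerBound ν N (rH + rL), hC,
      ⟨hrateH, hdH.hasDiversity herrH, hrateL, hdL.hasDiversity herrL⟩,
      ISI.lowerBound_antitone ν N (by linarith),
      ⟨le_rfl, ISI.lowerBound_le_upperBound hN hrH⟩, ⟨le_rfl, ISI.lowerBound_le_upperBound hN h0⟩,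
      (ISI.zeroPaddedTradeoff_eq hN hrH hrH').symm, (ISI.zeroPaddedTradeoff_eq hN h0 hr').symm⟩
  · exact (ISI.decaysAtMost_errH hN hrH hH1 C hC.rateH hpow).le_of_hasDiversity hC.divH
  -- The pair of messages is a single stream of rate `rH + rL`, and one of the two decoders errs
  -- whenever the pair is wrong.
  · have h2 := ISI.decaysAtMost_err_of_powerLE hN h0 h1
      (hpow.mono fun ρ h => (C ρ).powerLE_joint h) (hC.rateH.joint hC.rateL)
    exact (h2.mono fun ρ => (C ρ).err_joint_le).le_of_hasDiversity_add hC.divH hC.divL hle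
  · rw [← ISI.zeroPaddedTradeoff_eq hN hrH hrH']; exact ISI.zeroPaddedTradeoff_le_tradeoff ν N rH
  · exact ISI.tradeoff_le_upperBound hN hrH hH1
  · rw [← ISI.zeroPaddedTradeoff_eq hN h0 hr']; exact ISI.zeroPaddedTradeoff_le_tradeoff ν N _
  · exact ISI.tradeoff_le_upperBound hN h0 h1
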